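/- **Definitions.** For Boolean inputs $s=(s_0,\dots,s_{n-1})$ and $t=(t_0,\dots,t_{m-1})$, $m\ge 1$, the extended And-Or path is $f(s,t)=s_0\wedge\dots\wedge s_{n-1}\wedge\bigl(t_0\wedge(t_1\vee(t_2\wedge(t_3\vee\cdots)))\bigr)$; $f^*$ is its dual (And and Or exchanged). The size of a circuit over $\{\text{And},\text{Or}\}$ with fan-in two is its number of gates. Let $\rho(n)=n$ for $n\le 2$ and $\rho(n)=\lfloor 2\log_2(n-1)\rfloor$ for $n\ge 3$. Let $\xi\in[1.9961,2)$ be a real constant, $\mu(d,n)=\xi\,\frac{2^d-n-2}{d}+2$, and let $d_{\min}(n,m)$ be the smallest integer $d\ge 1$ with $m\le\mu(d,n)$. *Leftist circuits.* A leftist $\circ$-circuit on an ordered list of inputs consists of ordered full binary $\circ$-trees placed from left to right: as long as inputs are left, a full tree is put on the next $2^k$ of them, with $k$ maximum. For a set $K$ of its inputs, the boundary vertices $B(K)$ are the vertices all of whose inputs lie in $K$ while not all inputs of their successor (if any) do. *Symmetric trees.* The $\circ$-tree on $K$ and further operands $L$ with given arrival times is built by Huffman coding (repeatedly combining two operands with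 smallest arrival times; the result has arrival time one more than the larger of the two) on the elements of $B(K)$, each with its depth as arrival time, and on $L$. Its gates, $|B(K)|+|L|-1$ many, are new. *Triangular subset.* For $2^{d-1}\le|N|<2^d$, the subset $K(N)\subseteq N$ is the input set of the tree below a boundary vertex of $N$ of depth $d-1$ if there is one. Otherwise, let $D$ be the largest depth occurring twice among the boundary trees $T_0,T_1,\dots$ of $N$ (from left to right), and $\operatorname{depth}T_{j_0}=\operatorname{depth}T_{j_1}=D$ with $j_0<j_1$; then $K(N)$ is the set of all inputs of $T_{j_0},\dots,T_{j_1}$. *Algorithm.* For given $n$ and $m$, define global inputs $x_{2i}=s_i$ $(i<n)$ and $x_{2n+j}=t_j$ $(j<m)$. Construct a leftist And-circuit on all even and a leftist Or-circuit on all odd global inputs. Then construct a circuit $C(s,t)$ for $f(s,t)$ recursively, as follows. Circuits for $f^*$ are built by the same rules with And and Or exchanged; And-trees use the leftist And-circuit and Or-trees the leftist Or-circuit. In a call for $s=(s_0,\dots,s_{n-1})$, $t=(t_0,\dots,t_{m-1})$: 1. If $m\le 2$, return the symmetric tree on $K=s\cup\{t_0\}$ and $L=\{t_i: 1\le i<m\}$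 (arrival times $0$). Otherwise, let $d=d_{\min}(n,m)$. 2. If $d\le 3$ (whence $m\le5$): for $m=3$ return the symmetric tree on $K=s\cup\{t_0\}$ and $L=\{t_1\vee t_2\}$ (arrival time $1$); for $m=4$ the one on $K=s\cup\{t_0\}$ and $L=\{t_1\vee(t_2\wedge t_3)\}$ (arrival time $2$); for $m=5$ the conjunction of the symmetric tree on $K=s\cup\{t_0\}$ and $L=\{t_1\vee t_2\}$ (arrival time $1$) and the Or-tree on $K=\{t_1,t_3\}$ and $L=\{t_4\}$ (arrival time $0$). 3. If $n\ge 2^{d-1}$, let $s'=K(s)$ and return $\operatorname{sym}(s')\wedge C(s\setminus s',t)$, where $\operatorname{sym}$ denotes the symmetric And-tree (with $L=\emptyset$). 4. Otherwise, if $m\le\mu(d-1,0)$, return $\operatorname{sym}(s)\wedge C((),t)$. 5. Otherwise, let $k$ be the largest odd integer with $k\le\mu(d-1,n)$, $t'=(t_0,\dots,t_{k-1})$, $\widehat{t'}=(t_1,t_3,\dots,t_{k-2})$, $t''=(t_k,\dots,t_{m-1})$, and return $C(s,t')\wedge C^*(\widehat{t'},t'')$, where $C^*(\widehat{t'},t'')$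 is the circuit built for $f^*(\widehat{t'},t'')$. The resulting circuit consists of all gates of the two leftist circuits and all gates added by the recursion. **Theorem.** For all $n\ge 0$, $m\ge 1$ and every $\xi\in[1.9961,2)$, the algorithm terminates with a well-formed (acyclic) circuit on the inputs $s_0,\dots,s_{n-1},t_0,\dots,t_{m-1}$ that computes $f(s,t)$ and has size at most $$3.67\,m+n+\rho(n)-2 .$$ -/

import Mathlib

noncomputable section

namespace AndOrPath

/-! ### Boolean circuits over the basis of binary And and Or -/

/-- The two gate types. -/
inductive Op where
  | and
  | or
  deriving DecidableEq

def Op.dual : Op → Op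
  | .and => .or
  | .or => .and

def Op.apply : Op → Bool → Bool → Bool
  | .and, a, b => a && b
  | .or, a, b => a || b

/-- A vertex of a circuit: the input `x_i`, or the `j`-th gate. -/
inductive Vertex where
  | input (i : ℕ)
  | gate (j : ℕ)
  deriving DecidableEq

structure Gate where
  op : Op
  left : Vertex
  right : Vertex

/-- A circuit with one output. Gates are listed in topological order, see `Circuit.WellFormed`;
a vertex may have any number of successors. -/
structure Circuit where
  gates : List Gate
  output : Vertex

/-- The size of a circuit is the number of its gates. -/
def Circuit.size (C : Circuit) : ℕ := C.gates.length

/-- `v` is an input with index in `I` or one of the first `b` gates. -/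
def Vertex.Valid (I : List ℕ) (b : ℕ) : Vertex → Prop
  | .input i => i ∈ I
  | .gate j => j < b

/-- The circuit is a well-formed acyclic circuit on the inputs `x_i`, `i ∈ I`. -/
def Circuit.WellFormed (I : List ℕ) (C : Circuit) : Prop :=
  (∀ (j : ℕ) (h : j < C.gates.length),
    (C.gates[j]).left.Valid I j ∧ (C.gates[j]).right.Valid I j) ∧
  C.output.Valid I C.gates.length

/-- The value of a vertex, given the input values and the values of the gates. -/
def Vertex.value (x : ℕ → Bool) (vals : List Bool) : Vertex → Bool
  | .input i => x i
  | .gate j => vals.getD j false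

/-- The values of all gates, computed in topological order. -/
def gateValues (x : ℕ → Bool) (gates : List Gate) : List Bool :=
  gates.foldl
    (fun vals g => vals ++ [g.op.apply (g.left.value x vals) (g.right.value x vals)]) []

/-- The Boolean function computed by a circuit. -/
def Circuit.eval (C : Circuit) (x : ℕ → Bool) : Bool :=
  C.output.value x (gateValues x C.gates)

/-! ### Extended And-Or paths -/

/-- `altPath .and [t₀, t₁, t₂, …] = t₀ ∧ (t₁ ∨ (t₂ ∧ …))` is the And-Or path;
`altPath .or` is its dual. -/
def altPath : Op → List Bool → Bool
  | .and, [] => true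
  | .or, [] => false
  | _, [a] => a
  | p, a :: b :: l => p.apply a (altPath p.dual (b :: l))

/-- The extended And-Or path `f(s, t) = s₀ ∧ … ∧ s_{n-1} ∧ (t₀ ∧ (t₁ ∨ (t₂ ∧ …)))`. -/
def extAndOrPath {n m : ℕ} (s : Fin n → Bool) (t : Fin m → Bool) : Bool :=
  (List.ofFn s).all id && altPath .and (List.ofFn t)

/-- Global inputs: `x_{2 i} = s_i` for `i < n` and `x_{2 n + j} = t_j` for `j < m`. -/
def globalInput {n m : ℕ} (s : Fin n → Bool) (t : Fin m → Bool) (i : ℕ) : Bool :=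
  if i < 2 * n then
    (if h : i % 2 = 0 ∧ i / 2 < n then s ⟨i / 2, h.2⟩ else false)
  else if h : i - 2 * n < m then t ⟨i - 2 * n, h⟩ else false

/-- Indices of the symmetric inputs `s`. -/
def symInputs (n : ℕ) : List ℕ := (List.range n).map (fun i => 2 * i)

/-- Indices of the alternating inputs `t`. -/
def altInputs (n m : ℕ) : List ℕ := (List.range m).map (fun j => 2 * n + j)

/-- Indices of all global inputs, in increasing order. -/
def allInputs (n m : ℕ) : List ℕ := symInputs n ++ altInputs n m

/-! ### Leftist circuits -/

/-- A binary tree of vertices of a leftist circuit: a leaf is the input `x_i`,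
an inner node is the gate with number `g`. -/
inductive LTree where
  | leaf (i : ℕ)
  | node (g : ℕ) (l r : LTree)

namespace LTree

def root : LTree → Vertex
  | leaf i => .input i
  | node g _ _ => .gate g

def leaves : LTree → List ℕ
  | leaf i => [i]
  | node _ l r => l.leaves ++ r.leaves

def depth : LTree → ℕ
  | leaf _ => 0
  | node _ l r => max l.depth r.depth + 1

/-- The subtrees rooted at the boundary vertices of `K`, from left to right: the vertices all of
whose inputs lie in `K`, but not all inputs of their successor (if there is one). -/
def boundary (K : List ℕ) : LTree → List LTree
  | leaf i => if i ∈ K then [leaf i] else []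
  | node g l r =>
      if ∀ i ∈ (node g l r).leaves, i ∈ K then [node g l r]
      else l.boundary K ++ r.boundary K

end LTree

/-- The ordered full binary `op`-tree of depth `k` on the list `xs` of `2 ^ k` inputs,
with its gates, which get the numbers `g, g + 1, …`. -/
def fullTree (op : Op) : ℕ → List ℕ → ℕ → LTree × List Gate
  | 0, xs, _ => (.leaf (xs.headD 0), [])
  | k + 1, xs, g =>
      let L := fullTree op k (xs.take (2 ^ k)) g
      let R := fullTree op k (xs.drop (2 ^ k)) (g + L.2.length)
      (.node (g + L.2.length + R.2.length) L.1 R.1, L.2 ++ R.2 ++ [⟨op, L.1.root, R.1.root⟩])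

/-- The leftist `op`-circuit on the inputs `xs`: as long as inputs are left, put a full tree on
the next `2 ^ k` of them, with `k` maximum. Returns the trees from left to right, and the gates,
which get the numbers `g, g + 1, …`. -/
def leftist (op : Op) (xs : List ℕ) (g : ℕ) : List LTree × List Gate :=
  if h : xs = [] then ([], [])
  else
    let k := Nat.log 2 xs.length
    let T := fullTree op k (xs.take (2 ^ k)) g
    let R := leftist op (xs.drop (2 ^ k)) (g + T.2.length)
    (T.1 :: R.1, T.2 ++ R.2)
termination_by xs.length
decreasing_by
  have h1 : 0 < xs.length := List.length_pos_of_ne_nil h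
  have h2 : 0 < 2 ^ Nat.log 2 xs.length := by positivity
  rw [List.length_drop]
  omega

/-- The boundary tree sequence of `K` with respect to a leftist circuit. -/
def boundarySeq (F : List LTree) (K : List ℕ) : List LTree := F.flatMap (LTree.boundary K)

/-- The triangular subset extracted from `N`. With `2 ^ (d-1) ≤ |N| < 2 ^ d`, it consists of the
inputs of a boundary tree of depth `d - 1` if there is one; otherwise of the inputs of the
boundary trees `T_{j₀}, …, T_{j₁}`, where `T_{j₀}` and `T_{j₁}` are the two trees of the same,
maximum possible depth `D` (`none` if no depth occurs twice). -/
def triangularSubset (F : List LTree) (N : List ℕ) : Option (List ℕ) :=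
  let B := boundarySeq F N
  match B.find? (fun T => T.depth = Nat.log 2 N.length) with
  | some T => some T.leaves
  | none => do
      let depths := B.map LTree.depth
      let D ← (depths.filter (fun d' => 2 ≤ depths.count d')).max?
      some (((B.dropWhile (fun T => T.depth ≠ D)).rdropWhile (fun T => T.depth ≠ D)).flatMap
        LTree.leaves)

/-! ### Additional gates and symmetric trees -/

/-- A tree of additional gates; its leaves are existing vertices (inputs or gates of the leftist
circuits). Every `gate` node is one new gate. -/
inductive Term where
  | vertex (v : Vertex)
  | gate (op : Op) (l r : Term)

/-- The root vertex and the gates of a tree of additional gates, numbered `g, g + 1, …`. -/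
def Term.emit : Term → ℕ → Vertex × List Gate
  | .vertex v, _ => (v, [])
  | .gate op l r, g =>
      let L := l.emit g
      let R := r.emit (g + L.2.length)
      (.gate (g + L.2.length + R.2.length), L.2 ++ R.2 ++ [⟨op, L.1, R.1⟩])

/-- Sorted insertion by arrival time. -/
def insertByTime (a : ℕ × Term) : List (ℕ × Term) → List (ℕ × Term)
  | [] => [a]
  | b :: l => if a.1 ≤ b.1 then a :: b :: l else b :: insertByTime a l

theorem length_insertByTime (a : ℕ × Term) (l : List (ℕ × Term)) :
    (insertByTime a l).length = l.length + 1 := by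
  induction l with
  | nil => rfl
  | cons b l ih => simp only [insertByTime]; split <;> simp [ih]

/-- Huffman coding on a list of operands sorted by arrival time: repeatedly combine two operands
with the smallest arrival times. -/
def huffman (op : Op) : List (ℕ × Term) → Option Term
  | [] => none
  | [a] => some a.2
  | a :: b :: l => huffman op (insertByTime (max a.1 b.1 + 1, .gate op a.2 b.2) l)
termination_by l => l.length
decreasing_by simp [length_insertByTime]

/-- The delay-optimum symmetric `op`-tree on the inputs `K` of the leftist `op`-circuit `F`
(with arrival times `0`) and further operands `L` with given arrival times: Huffman coding on
the boundary vertices of `K`, each with its depth as arrival time, and on `L`. -/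
def symTree (op : Op) (F : List LTree) (K : List ℕ) (L : List (ℕ × Term)) : Option Term :=
  huffman op
    (((boundarySeq F K).map (fun T => (T.depth, Term.vertex T.root)) ++ L).foldr insertByTime [])

/-! ### The algorithm -/

/-- `μ(d, n)`: for depth `d` and `n` symmetric inputs, up to `μ(d, n)` alternating inputs are
allowed. -/
def mu (ξ : ℝ) (d n : ℕ) : ℝ := ξ * (2 ^ d - n - 2) / d + 2

/-- `d_min(n, m)`, the smallest `d ≥ 1` with `m ≤ μ(d, n)`. -/
def dMin (ξ : ℝ) (n m : ℕ) : ℕ := sInf {d : ℕ | 1 ≤ d ∧ (m : ℝ) ≤ mu ξ d n}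

/-- The largest odd integer that is at most `x`, for `x ≥ 1`. -/
def oddFloor (x : ℝ) : ℕ := if Odd ⌊x⌋₊ then ⌊x⌋₊ else ⌊x⌋₊ - 1

/-- `(t₀, t₁, t₂, t₃, …) ↦ (t₁, t₃, …)`. -/
def everySecond : List ℕ → List ℕ
  | _ :: b :: l => b :: everySecond l
  | _ => []

def inp (i : ℕ) : Term := .vertex (.input i)

/-- Solutions for at most two alternating inputs, or `d_min(n, m) ≤ 3`
(in which case there are at most five alternating inputs), for the gate type `p` and
the leftist circuits `F .and` and `F .or`. -/
def baseCase (F : Op → List LTree) (p : Op) (s : List ℕ) : List ℕ → Option Term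
  | [t₀] => symTree p (F p) (s ++ [t₀]) []
  | [t₀, t₁] => symTree p (F p) (s ++ [t₀]) [(0, inp t₁)]
  | [t₀, t₁, t₂] => symTree p (F p) (s ++ [t₀]) [(1, .gate p.dual (inp t₁) (inp t₂))]
  | [t₀, t₁, t₂, t₃] =>
      symTree p (F p) (s ++ [t₀])
        [(2, .gate p.dual (inp t₁) (.gate p (inp t₂) (inp t₃)))]
  | [t₀, t₁, t₂, t₃, t₄] => do
      let a ← symTree p (F p) (s ++ [t₀]) [(1, .gate p.dual (inp t₁) (inp t₂))]
      let b ← symTree p.dual (F p.dual) [t₁, t₃] [(0, inp t₄)]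
      some (.gate p a b)
  | _ => none

/-- The recursive construction for `f(s, t)` (`p = .and`) or its dual `f*(s, t)` (`p = .or`), using
the leftist circuits `F .and` and `F .or`. The first numerical argument only bounds the depth of
the recursion: the result is `none` if the bound is exceeded. -/
def build (ξ : ℝ) (F : Op → List LTree) : ℕ → Op → List ℕ → List ℕ → Option Term
  | 0, _, _, _ => none
  | fuel + 1, p, s, t =>
      let n := s.length
      let m := t.length
      let d := dMin ξ n m
      if m ≤ 2 ∨ d ≤ 3 then
        baseCase F p s t
      else if 2 ^ (d - 1) ≤ n then do
        -- symmetric split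
        let s' ← triangularSubset (F p) s
        let a ← symTree p (F p) s' []
        let b ← build ξ F fuel p (s.filter (fun i => i ∉ s')) t
        some (.gate p a b)
      else if (m : ℝ) ≤ mu ξ (d - 1) 0 then do
        -- simple split
        let a ← symTree p (F p) s []
        let b ← build ξ F fuel p [] t
        some (.gate p a b)
      else do
        -- alternating split with a prefix of odd length
        let k := oddFloor (mu ξ (d - 1) n)
        let a ← build ξ F fuel p s (t.take k)
        let b ← build ξ F fuel p.dual (everySecond (t.take k)) (t.drop k)
        some (.gate p a b)

/-- The circuit constructed for `n` symmetric and `m` alternating inputs: a leftist And-circuit on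
all even global inputs, a leftist Or-circuit on all odd global inputs, and the additional gates.
Every recursive call has smaller `n + m`, so `n + m` bounds the recursion depth. -/
def andOrPathCircuit (ξ : ℝ) (n m : ℕ) : Option Circuit := do
  let S₀ := leftist .and ((allInputs n m).filter (fun i => i % 2 = 0)) 0
  let S₁ := leftist .or ((allInputs n m).filter (fun i => i % 2 = 1)) S₀.2.length
  let F : Op → List LTree := fun p => match p with
    | .and => S₀.1
    | .or => S₁.1
  let e ← build ξ F (n + m) .and (symInputs n) (altInputs n m)
  let R := e.emit (S₀.2.length + S₁.2.length)
  some ⟨S₀.2 ++ S₁.2 ++ R.2, R.1⟩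

/-- The function `ρ`. -/
def rho (n : ℕ) : ℕ := if n ≤ 2 then n else ⌊2 * Real.logb 2 ((n : ℝ) - 1)⌋₊

end AndOrPath

end

noncomputable section

namespace AndOrPath

/-! ### Iterated And and Or -/

/-! The size splits into the gates of the two leftist circuits and the gates added by the recursion.
For `m ≥ 2` the former number at most `n + m - 2`, so it remains to bound the latter by `ρ(n) + 2.67
m`.

The recursion is charged by the invariant `|B(s)| + bound j m` (`ForestSpec.exists_build`), where `j
≥ 3` is any level with `m ≤ μ(j, 0)`, not necessarily `d_min(n, m)`. A symmetric tree on `K` reuses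
the trees of the leftist circuit, so it costs `|B(K)| - 1` new gates, and `|B(K)|` together with the
gate joining it to the rest. The triangular subset `s'` is a union of boundary trees of `s`, hence
`|B(s')| + |B(s \ s')| = |B(s)|` (`exists_triangularSubset`), and symmetric and simple splits are
paid for exactly by `|B(s)|`.

Only an alternating split with prefix length `k` costs more: one gate plus `c`, the number of
boundary vertices of the `(k - 1) / 2` inputs passed to the dual call. These inputs form an interval
of the dual leftist circuit. An interval of length `l` has `a + b` boundary vertices with `2^a + 2^b
≤ l + 2`, whence `c ≤ 2 log₂ (k + 3) - 4`. An alternating split at depth `d + 1` happens only if `m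
> μ(d, 0)`, which forces `d + 1 ≤ j`, and both parts then have at most `μ(d, 0)` alternating inputs
(`mu_succ_sub_le`). Spread over more than `μ(d, 0) ≈ 2^(d+1) / d` inputs, the extra cost per input
is of order `d² / 2^d`. This is summable over `d`, and `bound_add_add_le` keeps the sum below 2.67.

The interval estimate applied to `s` itself gives `ρ(n)` (`le_rho`). Correctness of the alternating
split is the Boolean identity `altPath_append`. -/

/-- The iterated And (Or) of a list of Boolean values. -/
def bigOp : Op → List Bool → Bool
  | .and, l => l.all id
  | .or, l => l.any id

theorem bigOp_cons (p : Op) (a : Bool) (l : List Bool) :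
    bigOp p (a :: l) = p.apply a (bigOp p l) := by
  cases p <;> simp [bigOp, Op.apply]

theorem bigOp_singleton (p : Op) (a : Bool) : bigOp p [a] = a := by
  cases p <;> simp [bigOp]

theorem bigOp_append (p : Op) (l l' : List Bool) :
    bigOp p (l ++ l') = p.apply (bigOp p l) (bigOp p l') := by
  cases p <;> simp [bigOp, Op.apply]

theorem bigOp_perm (p : Op) {l l' : List Bool} (h : l.Perm l') : bigOp p l = bigOp p l' := by
  cases p
  · exact h.all_eq
  · exact h.any_eq

theorem bigOp_map_congr (p : Op) (x : ℕ → Bool) {K K' : List ℕ} (h : ∀ i, i ∈ K ↔ i ∈ K') :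
    bigOp p (K.map x) = bigOp p (K'.map x) := by
  cases p <;> rw [Bool.eq_iff_iff] <;> simp [bigOp, h]

theorem bigOp_flatMap {α : Type*} (p : Op) (x : ℕ → Bool) (f : α → List ℕ) (B : List α) :
    bigOp p ((B.flatMap f).map x) = bigOp p (B.map fun T => bigOp p ((f T).map x)) := by
  induction B with
  | nil => rfl
  | cons T B ih =>
    rw [List.flatMap_cons, List.map_append, bigOp_append, ih, List.map_cons, bigOp_cons]

theorem apply_assoc (p : Op) (a b c : Bool) :
    p.apply (p.apply a b) c = p.apply a (p.apply b c) := by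
  cases p <;> simp [Op.apply, Bool.and_assoc, Bool.or_assoc]

theorem apply_bigOp_nil (p : Op) (a : Bool) : p.apply (bigOp p []) a = a := by
  cases p <;> simp [Op.apply, bigOp]

theorem apply_bigOp_nil_right (p : Op) (a : Bool) : p.apply a (bigOp p []) = a := by
  cases p <;> simp [Op.apply, bigOp]

@[simp] theorem Op.dual_dual (p : Op) : p.dual.dual = p := by cases p <;> rfl

/-! ### Alternating paths and their splitting -/

theorem altPath_cons (p : Op) (a : Bool) (l : List Bool) (hl : l ≠ []) :
    altPath p (a :: l) = p.apply a (altPath p.dual l) := by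
  cases l with
  | nil => exact absurd rfl hl
  | cons b l => cases p <;> rfl

theorem altPath_singleton (p : Op) (a : Bool) : altPath p [a] = a := by
  cases p <;> rfl

/-- The alternating split with a prefix of odd length. -/
theorem altPath_append (x : ℕ → Bool) (p : Op) (A B : List ℕ) (hA : Odd A.length) (hB : B ≠ []) :
    altPath p ((A ++ B).map x) = p.apply (altPath p (A.map x))
      (p.dual.apply (bigOp p.dual ((everySecond A).map x)) (altPath p.dual (B.map x))) := by
  induction hn : A.length using Nat.strong_induction_on generalizing A with
  | _ n ih =>
    match A, hA, hn with
    | [a], _, _ =>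
      rw [List.singleton_append, List.map_cons, altPath_cons _ _ _ (by simpa using hB)]
      simp only [everySecond, List.map_nil, apply_bigOp_nil, List.map_cons, altPath_singleton]
    | [a, b], hA, _ => exact absurd hA (by simp)
    | a :: b :: c :: A, hA, hn =>
      have h1 := ih (c :: A).length (by simp at hn ⊢; omega) (c :: A)
        (by simp only [List.length_cons, Nat.odd_iff] at hA ⊢; omega) rfl
      simp only [List.cons_append, List.map_cons] at h1 ⊢
      rw [altPath_cons _ _ _ (by simp), altPath_cons _ _ _ (by simp),
        altPath_cons p _ _ (by simp), altPath_cons _ (x b) (x c :: _) (by simp)]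
      simp only [everySecond, List.map_cons, Op.dual_dual, bigOp_cons]
      rw [h1]
      -- What is left is distributivity: for `p = .and` it reads `y ∧ (z ∨ (u ∧ (v ∨ w))) = (y ∧ (z
      -- ∨ u)) ∧ ((z ∨ v) ∨ w)`.
      generalize altPath p _ = u
      generalize bigOp p.dual _ = v
      generalize altPath p.dual _ = w
      generalize x a = y
      generalize x b = z
      revert u v w y z
      cases p <;> decide

/-! ### Evaluation of circuits -/

theorem gateValues_append_singleton (x : ℕ → Bool) (G : List Gate) (g : Gate) :
    gateValues x (G ++ [g]) = gateValues x G ++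
      [g.op.apply (g.left.value x (gateValues x G)) (g.right.value x (gateValues x G))] := by
  simp [gateValues]

theorem length_gateValues (x : ℕ → Bool) (G : List Gate) :
    (gateValues x G).length = G.length := by
  induction G using List.reverseRecOn with
  | nil => rfl
  | append_singleton G g ih => simp [gateValues_append_singleton, ih]

theorem exists_gateValues_append (x : ℕ → Bool) (G H : List Gate) :
    ∃ vs, gateValues x (G ++ H) = gateValues x G ++ vs := by
  induction H using List.reverseRecOn with
  | nil => exact ⟨[], by simp⟩
  | append_singleton H g ih =>
    obtain ⟨vs, h⟩ := ih
    rw [← List.append_assoc, gateValues_append_singleton, h, List.append_assoc]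
    exact ⟨_, rfl⟩

theorem Vertex.Valid.mono {I : List ℕ} {b c : ℕ} (h : b ≤ c) {v : Vertex} (hv : v.Valid I b) :
    v.Valid I c := by
  cases v with
  | input i => exact hv
  | gate j => exact lt_of_lt_of_le hv h

theorem Vertex.value_append {I : List ℕ} {v : Vertex} {G : List Gate} (hv : v.Valid I G.length)
    (H : List Gate) (x : ℕ → Bool) :
    v.value x (gateValues x (G ++ H)) = v.value x (gateValues x G) := by
  obtain ⟨vs, h⟩ := exists_gateValues_append x G H
  cases v with
  | input i => rfl
  | gate j =>
    simp only [Vertex.value, h]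
    exact List.getD_append _ _ _ _ (by rw [length_gateValues]; exact hv)

theorem Vertex.value_last (x : ℕ → Bool) (G : List Gate) (g : Gate) :
    (Vertex.gate G.length).value x (gateValues x (G ++ [g])) =
      g.op.apply (g.left.value x (gateValues x G)) (g.right.value x (gateValues x G)) := by
  simp [gateValues_append_singleton, Vertex.value, length_gateValues]

/-- The gates `H`, with numbers `g, g + 1, …`, only use inputs in `I` and earlier gates. -/
def GatesFrom (I : List ℕ) (g : ℕ) (H : List Gate) : Prop :=
  ∀ (j : ℕ) (h : j < H.length), H[j].left.Valid I (g + j) ∧ H[j].right.Valid I (g + j)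

theorem GatesFrom.nil (I : List ℕ) (g : ℕ) : GatesFrom I g [] := fun j h => by simp at h

theorem GatesFrom.singleton {I : List ℕ} {g : ℕ} {a : Gate} (hl : a.left.Valid I g)
    (hr : a.right.Valid I g) : GatesFrom I g [a] := by
  intro j h
  obtain rfl : j = 0 := by simpa using h
  exact ⟨hl, hr⟩

theorem GatesFrom.append {I : List ℕ} {g : ℕ} {A B : List Gate} (hA : GatesFrom I g A)
    (hB : GatesFrom I (g + A.length) B) : GatesFrom I g (A ++ B) := by
  intro j h
  rw [List.getElem_append]
  split
  · next h' => exact hA j h'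
  · next h' =>
    have := hB (j - A.length) (by rw [List.length_append] at h; omega)
    rwa [show g + A.length + (j - A.length) = g + j by omega] at this

/-! ### Trees of additional gates -/

def Term.size : Term → ℕ
  | .vertex _ => 0
  | .gate _ l r => l.size + r.size + 1

def Term.Valid (I : List ℕ) (b : ℕ) : Term → Prop
  | .vertex v => v.Valid I b
  | .gate _ l r => l.Valid I b ∧ r.Valid I b

def Term.eval (x : ℕ → Bool) (vals : List Bool) : Term → Bool
  | .vertex v => v.value x vals
  | .gate op l r => op.apply (l.eval x vals) (r.eval x vals)

theorem Term.Valid.mono {I : List ℕ} {b c : ℕ} (h : b ≤ c) {e : Term} (he : e.Valid I b) :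
    e.Valid I c := by
  induction e with
  | vertex v => exact Vertex.Valid.mono h he
  | gate op l r ihl ihr => exact ⟨ihl he.1, ihr he.2⟩

theorem Term.eval_append {I : List ℕ} {e : Term} {G : List Gate} (he : e.Valid I G.length)
    (H : List Gate) (x : ℕ → Bool) :
    e.eval x (gateValues x (G ++ H)) = e.eval x (gateValues x G) := by
  induction e with
  | vertex v => exact Vertex.value_append he H x
  | gate op l r ihl ihr => simp only [Term.eval, ihl he.1, ihr he.2]

theorem Term.length_emit (e : Term) (g : ℕ) : (e.emit g).2.length = e.size := by
  induction e generalizing g with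
  | vertex v => rfl
  | gate op l r ihl ihr => simp [Term.emit, Term.size, ihl, ihr, add_assoc]

theorem Term.emit_valid {I : List ℕ} {e : Term} {g : ℕ} (he : e.Valid I g) :
    GatesFrom I g (e.emit g).2 ∧ (e.emit g).1.Valid I (g + e.size) := by
  induction e generalizing g with
  | vertex v => exact ⟨GatesFrom.nil _ _, he⟩
  | gate op l r ihl ihr =>
    obtain ⟨hl, hl'⟩ := ihl he.1
    obtain ⟨hr, hr'⟩ := ihr (he.2.mono (Nat.le_add_right g l.size))
    simp only [Term.emit, Term.length_emit]
    refine ⟨(hl.append (by rwa [Term.length_emit])).append (GatesFrom.singleton ?_ ?_), ?_⟩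
    · exact hl'.mono (by simp [Term.length_emit])
    · exact hr'.mono (by simp [Term.length_emit, add_assoc])
    · simp only [Vertex.Valid, Term.size]; omega

/-- The leaves of a term refer only to vertices of `G`, so the gates emitted for one subterm do not
change the value of the other. -/
theorem Term.emit_value {I : List ℕ} {e : Term} {G : List Gate} (he : e.Valid I G.length)
    (x : ℕ → Bool) :
    (e.emit G.length).1.value x (gateValues x (G ++ (e.emit G.length).2)) =
      e.eval x (gateValues x G) := by
  induction e generalizing G with
  | vertex v => simp [Term.emit, Term.eval]
  | gate op l r ihl ihr =>
    have h1 := ihl he.1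
    obtain ⟨-, vl⟩ := Term.emit_valid he.1
    set A := (l.emit G.length).2 with hA
    have lA : A.length = l.size := Term.length_emit _ _
    have hr : r.Valid I (G ++ A).length := he.2.mono (by simp)
    have h2 := ihr (G := G ++ A) hr
    obtain ⟨-, vr⟩ := Term.emit_valid hr
    set B := (r.emit (G ++ A).length).2 with hB
    have lB : B.length = r.size := Term.length_emit _ _
    have hB' : (r.emit (G.length + A.length)).2 = B := by rw [hB, List.length_append]
    have hlen : G.length + A.length + B.length = (G ++ A ++ B).length := by
      simp [add_assoc]
    have hfull : G ++ (A ++ B ++ [⟨op, (l.emit G.length).1, (r.emit (G ++ A).length).1⟩]) =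
        (G ++ A ++ B) ++ [⟨op, (l.emit G.length).1, (r.emit (G ++ A).length).1⟩] := by simp
    simp only [Term.emit, ← hA, hB', hlen]
    rw [← List.length_append, hfull, Vertex.value_last]
    simp only [Term.eval]
    rw [h2, Term.eval_append he.2, Vertex.value_append (I := I) (by simpa [lA] using vl), h1]

/-! ### Huffman coding -/

theorem insertByTime_perm (a : ℕ × Term) (l : List (ℕ × Term)) :
    (insertByTime a l).Perm (a :: l) := by
  induction l with
  | nil => rfl
  | cons b l ih =>
    simp only [insertByTime]
    split
    · rfl
    · exact (ih.cons b).trans (List.Perm.swap a b l)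

theorem foldr_insertByTime_perm (l : List (ℕ × Term)) : (l.foldr insertByTime []).Perm l := by
  induction l with
  | nil => rfl
  | cons a l ih => exact (insertByTime_perm a _).trans (ih.cons a)

/-- Each combination replaces two operands by one with one new gate, so neither the value nor the
gate count depends on the order. Arrival times play no role for the size. -/
theorem exists_huffman (op : Op) (l : List (ℕ × Term)) (hl : l ≠ []) :
    ∃ e, huffman op l = some e ∧ e.size + 1 = (l.map fun a => a.2.size + 1).sum ∧
      (∀ x vals, e.eval x vals = bigOp op (l.map fun a => a.2.eval x vals)) ∧
      ∀ I b, (∀ a ∈ l, a.2.Valid I b) → e.Valid I b := by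
  induction hn : l.length using Nat.strong_induction_on generalizing l with
  | _ n ih =>
    match l, hl, hn with
    | [a], _, _ => exact ⟨a.2, by simp [huffman], by simp, by simp [bigOp_singleton], by simp⟩
    | a :: b :: l, _, hn =>
      set c : ℕ × Term := (max a.1 b.1 + 1, .gate op a.2 b.2)
      have hp := insertByTime_perm c l
      obtain ⟨e, h1, h2, h3, h4⟩ := ih (insertByTime c l).length
        (by rw [length_insertByTime]; simp at hn; omega) (insertByTime c l)
        (by intro h; have := length_insertByTime c l; simp [h] at this) rfl
      refine ⟨e, by rw [huffman, h1], ?_, fun x vals => ?_, fun I b' h => ?_⟩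
      · rw [h2, (hp.map _).sum_eq]
        simp only [List.map_cons, List.sum_cons, c, Term.size]
        omega
      · rw [h3, bigOp_perm op (hp.map _)]
        simp only [List.map_cons, bigOp_cons, c, Term.eval, apply_assoc]
      · refine h4 I b' fun a' ha' => ?_
        rcases List.mem_cons.1 (hp.mem_iff.1 ha') with rfl | h'
        · exact ⟨h a (by simp), h b (by simp)⟩
        · exact h a' (by simp [h'])

/-! ### Boundary trees -/

namespace LTree

/-- All subtrees of a tree satisfy `P`. -/
def Forall (P : LTree → Prop) : LTree → Prop
  | leaf i => P (leaf i)
  | node g l r => P (node g l r) ∧ l.Forall P ∧ r.Forall P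

theorem Forall.self {P : LTree → Prop} {T : LTree} (h : T.Forall P) : P T := by
  cases T with
  | leaf i => exact h
  | node g l r => exact h.1

theorem Forall.mono {P Q : LTree → Prop} (hPQ : ∀ T, P T → Q T) {T : LTree} (h : T.Forall P) :
    T.Forall Q := by
  induction T with
  | leaf i => exact hPQ _ h
  | node g l r ihl ihr => exact ⟨hPQ _ h.1, ihl h.2.1, ihr h.2.2⟩

theorem leaves_ne_nil (T : LTree) : T.leaves ≠ [] := by
  induction T with
  | leaf i => simp [leaves]
  | node g l r ihl ihr => simp [leaves, ihl]

theorem boundary_eq_self {K : List ℕ} {T : LTree} (h : ∀ i ∈ T.leaves, i ∈ K) :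
    T.boundary K = [T] := by
  cases T with
  | leaf i => simp [boundary, h i (by simp [leaves])]
  | node g l r => rw [boundary, if_pos h]

theorem boundary_eq_nil {K : List ℕ} {T : LTree} (h : ∀ i ∈ T.leaves, i ∉ K) :
    T.boundary K = [] := by
  induction T with
  | leaf i => simp [boundary, h i (by simp [leaves])]
  | node g l r ihl ihr =>
    obtain ⟨i, hi⟩ := List.exists_mem_of_ne_nil _ (leaves_ne_nil (node g l r))
    rw [boundary, if_neg fun h' => h i hi (h' i hi), ihl fun i hi => h i (by simp [leaves, hi]),
      ihr fun i hi => h i (by simp [leaves, hi]), List.append_nil]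

theorem boundary_congr {K K' : List ℕ} {T : LTree} (h : ∀ i ∈ T.leaves, i ∈ K ↔ i ∈ K') :
    T.boundary K = T.boundary K' := by
  induction T with
  | leaf i => simp [boundary, h i (by simp [leaves])]
  | node g l r ihl ihr =>
    have h1 : (∀ i ∈ (node g l r).leaves, i ∈ K) ↔ ∀ i ∈ (node g l r).leaves, i ∈ K' :=
      forall₂_congr fun i hi => h i hi
    simp only [boundary, h1, ihl fun i hi => h i (by simp [leaves, hi]),
      ihr fun i hi => h i (by simp [leaves, hi])]

theorem forall_of_mem_boundary {P : LTree → Prop} {K : List ℕ} {T S : LTree} (h : T.Forall P)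
    (hS : S ∈ T.boundary K) : P S := by
  induction T with
  | leaf i =>
    simp only [boundary] at hS
    split at hS
    · obtain rfl := List.mem_singleton.1 hS
      exact h
    · simp at hS
  | node g l r ihl ihr =>
    simp only [boundary] at hS
    split at hS
    · obtain rfl := List.mem_singleton.1 hS
      exact h.1
    · rcases List.mem_append.1 hS with hS | hS
      · exact ihl h.2.1 hS
      · exact ihr h.2.2 hS

theorem flatMap_leaves_boundary (K : List ℕ) (T : LTree) :
    (T.boundary K).flatMap leaves = T.leaves.filter (fun i => i ∈ K) := by
  induction T with
  | leaf i => by_cases h : i ∈ K <;> simp [boundary, leaves, h]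
  | node g l r ihl ihr =>
    simp only [boundary]
    split
    · next h =>
      rw [List.filter_eq_self.2 fun i hi => by simpa using h i hi, List.flatMap_cons,
        List.flatMap_nil, List.append_nil]
    · rw [List.flatMap_append, ihl, ihr, leaves, List.filter_append]

/-- Either `a` completes the tree and the boundary collapses to the root, or, the leaves being
distinct, only one of the two subtrees is affected. -/
theorem length_boundary_append_le (K : List ℕ) (a : ℕ) {T : LTree} (hT : T.leaves.Nodup) :
    (T.boundary (K ++ [a])).length ≤ (T.boundary K).length + 1 := by
  induction T with
  | leaf i => simp only [boundary]; split <;> split <;> simp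
  | node g l r ihl ihr =>
    by_cases h : ∀ i ∈ (node g l r).leaves, i ∈ K ++ [a]
    · rw [boundary_eq_self h]; simp
    · have h' : ¬ ∀ i ∈ (node g l r).leaves, i ∈ K :=
        fun h' => h fun i hi => List.mem_append_left _ (h' i hi)
      rw [boundary, boundary, if_neg h, if_neg h', List.length_append, List.length_append]
      rw [leaves, List.nodup_append'] at hT
      have key : ∀ S : LTree, a ∉ S.leaves → S.boundary (K ++ [a]) = S.boundary K := by
        refine fun S hS => boundary_congr fun i hi => ?_
        have : i ≠ a := fun h => hS (h ▸ hi)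
        simp [this]
      by_cases hl : a ∈ l.leaves
      · rw [key r fun hr => hT.2.2 hl hr]
        have := ihl hT.1
        omega
      · rw [key l hl]
        have := ihr hT.2.1
        omega

/-- The boundary of a subset `K'` of `K` none of whose boundary trees is cut by `K'`. -/
theorem boundary_eq_filter {K K' : List ℕ} (hK : ∀ i ∈ K', i ∈ K) {T : LTree}
    (h : ∀ S ∈ T.boundary K, (∀ i ∈ S.leaves, i ∈ K') ∨ ∀ i ∈ S.leaves, i ∉ K') :
    T.boundary K' = (T.boundary K).filter (fun S => ∀ i ∈ S.leaves, i ∈ K') := by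
  by_cases hT : ∀ i ∈ T.leaves, i ∈ K
  · rw [boundary_eq_self hT] at h ⊢
    rcases h T (by simp) with h | h
    · rw [boundary_eq_self h, List.filter_cons_of_pos (by simpa using h), List.filter_nil]
    · obtain ⟨i, hi⟩ := List.exists_mem_of_ne_nil _ (leaves_ne_nil T)
      rw [boundary_eq_nil h, List.filter_cons_of_neg, List.filter_nil]
      simpa using ⟨i, hi, h i hi⟩
  · induction T with
    | leaf i =>
      have hi : i ∉ K := fun hi => hT (by simpa [leaves] using hi)
      have hi' : i ∉ K' := fun h => hi (hK i h)
      simp [boundary, hi, hi']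
    | node g l r ihl ihr =>
      have hT' : ¬ ∀ i ∈ (node g l r).leaves, i ∈ K' := fun h => hT fun i hi => hK i (h i hi)
      rw [boundary, if_neg hT] at h
      rw [boundary, boundary, if_neg hT, if_neg hT', List.filter_append]
      -- A half contained in `K` is a single boundary tree, kept or dropped as a whole. The
      -- induction hypothesis covers only halves not contained in `K`.
      have aux : ∀ S : LTree, (∀ S' ∈ S.boundary K, (∀ i ∈ S'.leaves, i ∈ K') ∨
          ∀ i ∈ S'.leaves, i ∉ K') → (∀ i ∈ S.leaves, i ∈ K) →
          S.boundary K' = (S.boundary K).filter (fun S => ∀ i ∈ S.leaves, i ∈ K') := by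
        intro S h hS
        rw [boundary_eq_self hS] at h ⊢
        rcases h S (by simp) with h | h
        · rw [boundary_eq_self h, List.filter_cons_of_pos (by simpa using h), List.filter_nil]
        · obtain ⟨i, hi⟩ := List.exists_mem_of_ne_nil _ (leaves_ne_nil S)
          rw [boundary_eq_nil h, List.filter_cons_of_neg, List.filter_nil]
          simpa using ⟨i, hi, h i hi⟩
      have hl : ∀ S ∈ l.boundary K, _ := fun S hS => h S (List.mem_append_left _ hS)
      have hr : ∀ S ∈ r.boundary K, _ := fun S hS => h S (List.mem_append_right _ hS)
      congr 1
      · by_cases hlK : ∀ i ∈ l.leaves, i ∈ K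
        · exact aux l hl hlK
        · exact ihl hl hlK
      · by_cases hrK : ∀ i ∈ r.leaves, i ∈ K
        · exact aux r hr hrK
        · exact ihr hr hrK

end LTree

theorem flatMap_leaves_boundarySeq (F : List LTree) (K : List ℕ) :
    (boundarySeq F K).flatMap LTree.leaves = (F.flatMap LTree.leaves).filter (fun i => i ∈ K) := by
  rw [boundarySeq, List.flatMap_assoc, List.filter_flatMap]
  simp only [LTree.flatMap_leaves_boundary]

theorem length_boundarySeq_append_le (F : List LTree) (K : List ℕ) (a : ℕ)
    (hF : (F.flatMap LTree.leaves).Nodup) :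
    (boundarySeq F (K ++ [a])).length ≤ (boundarySeq F K).length + 1 := by
  induction F with
  | nil => simp [boundarySeq]
  | cons T F ih =>
    rw [List.flatMap_cons, List.nodup_append'] at hF
    simp only [boundarySeq, List.flatMap_cons, List.length_append] at ih ⊢
    by_cases ha : a ∈ T.leaves
    · have h1 : F.flatMap (LTree.boundary (K ++ [a])) = F.flatMap (LTree.boundary K) := by
        refine List.flatMap_congr fun S hS => LTree.boundary_congr fun i hi => ?_
        have : i ≠ a := by
          rintro rfl
          exact hF.2.2 ha (List.mem_flatMap.2 ⟨S, hS, hi⟩)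
        simp [this]
      rw [h1]
      have := LTree.length_boundary_append_le K a hF.1
      omega
    · have h1 : T.boundary (K ++ [a]) = T.boundary K := by
        refine LTree.boundary_congr fun i hi => ?_
        have : i ≠ a := fun h => ha (h ▸ hi)
        simp [this]
      rw [h1]
      have := ih hF.2.1
      omega

theorem boundarySeq_eq_filter {F : List LTree} {K K' : List ℕ} (hK : ∀ i ∈ K', i ∈ K)
    (h : ∀ S ∈ boundarySeq F K, (∀ i ∈ S.leaves, i ∈ K') ∨ ∀ i ∈ S.leaves, i ∉ K') :
    boundarySeq F K' = (boundarySeq F K).filter (fun S => ∀ i ∈ S.leaves, i ∈ K') := by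
  rw [boundarySeq, boundarySeq, List.filter_flatMap]
  exact List.flatMap_congr fun T hT =>
    LTree.boundary_eq_filter hK fun S hS => h S (List.mem_flatMap.2 ⟨T, hT, hS⟩)

/-! ### The triangular subset -/

theorem mem_dropWhile_of_mem {α : Type*} {p : α → Bool} {a : α} {l : List α} (ha : a ∈ l)
    (hp : p a = false) : a ∈ l.dropWhile p := by
  induction l with
  | nil => simp at ha
  | cons b l ih =>
    rw [List.dropWhile_cons]
    split
    · next hb =>
      rcases List.mem_cons.1 ha with rfl | h
      · simp [hp] at hb
      · exact ih h
    · exact ha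

/-- The set extracted is the union of some boundary trees of `s`. Cutting along whole boundary trees
neither splits nor merges any of them, so the numbers of boundary vertices add up. This is what
makes symmetric splits free. -/
theorem exists_triangularSubset {F : List LTree} {s : List ℕ}
    (hF : (F.flatMap LTree.leaves).Nodup) (hs : s.Nodup) (hsF : ∀ i ∈ s, i ∈ F.flatMap LTree.leaves)
    (hfull : ∀ T ∈ boundarySeq F s, T.leaves.length = 2 ^ T.depth) (hne : s ≠ []) :
    ∃ s', triangularSubset F s = some s' ∧ s' ≠ [] ∧ (∀ i ∈ s', i ∈ s) ∧
      (boundarySeq F s').length + (boundarySeq F (s.filter fun i => i ∉ s')).length =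
        (boundarySeq F s).length := by
  set B := boundarySeq F s with hB
  have hleaves : B.flatMap LTree.leaves = (F.flatMap LTree.leaves).filter (fun i => i ∈ s) :=
    flatMap_leaves_boundarySeq F s
  have hnd : (B.flatMap LTree.leaves).Nodup := hleaves ▸ hF.filter _
  have hmem : ∀ i, i ∈ B.flatMap LTree.leaves ↔ i ∈ s := by
    intro i
    rw [hleaves, List.mem_filter]
    simpa using hsF i
  have hsum : (B.map fun T => 2 ^ T.depth).sum = s.length := by
    rw [← ((List.perm_ext_iff_of_nodup hnd hs).2 hmem).length_eq, List.length_flatMap]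
    exact congrArg List.sum (List.map_congr_left fun T hT => (hfull T hT).symm)
  -- The additivity needs nothing about the choice of the trees: any nonempty selection `B'` of
  -- boundary trees works.
  have key : ∀ B' : List LTree, B' ≠ [] → (∀ T ∈ B', T ∈ B) →
      B'.flatMap LTree.leaves ≠ [] ∧ (∀ i ∈ B'.flatMap LTree.leaves, i ∈ s) ∧
      (boundarySeq F (B'.flatMap LTree.leaves)).length +
        (boundarySeq F (s.filter fun i => i ∉ B'.flatMap LTree.leaves)).length = B.length := by
    intro B' hB' hsub
    set s' := B'.flatMap LTree.leaves with hs'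
    have h1 : ∀ i ∈ s', i ∈ s := by
      intro i hi
      obtain ⟨T, hT, hi⟩ := List.mem_flatMap.1 hi
      exact (hmem i).1 (List.mem_flatMap.2 ⟨T, hsub T hT, hi⟩)
    have h2 : ∀ S ∈ B, (∀ i ∈ S.leaves, i ∈ s') ∨ ∀ i ∈ S.leaves, i ∉ s' := by
      intro S hS
      by_cases hSB : S ∈ B'
      · exact Or.inl fun i hi => List.mem_flatMap.2 ⟨S, hSB, hi⟩
      · refine Or.inr fun i hi hi' => ?_
        obtain ⟨T, hT, hiT⟩ := List.mem_flatMap.1 hi'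
        have hST : S ≠ T := fun h => hSB (h ▸ hT)
        have : Std.Symm (Function.onFun List.Disjoint LTree.leaves) := ⟨fun _ _ h => h.symm⟩
        exact (List.nodup_flatMap.1 hnd).2.forall hS (hsub T hT) hST hi hiT
    have hSs : ∀ S ∈ B, ∀ i ∈ S.leaves, i ∈ s := fun S hS i hi =>
      (hmem i).1 (List.mem_flatMap.2 ⟨S, hS, hi⟩)
    refine ⟨?_, h1, ?_⟩
    · obtain ⟨T, hT⟩ := List.exists_mem_of_ne_nil _ hB'
      obtain ⟨i, hi⟩ := List.exists_mem_of_ne_nil _ T.leaves_ne_nil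
      exact List.ne_nil_of_mem (List.mem_flatMap.2 ⟨T, hT, hi⟩)
    · rw [boundarySeq_eq_filter h1 h2, boundarySeq_eq_filter (K := s)
        (K' := s.filter fun i => i ∉ s') (fun i hi => (List.mem_filter.1 hi).1), ← hB,
        List.length_eq_length_filter_add (l := B) (fun S => ∀ i ∈ S.leaves, i ∈ s')]
      · congr 2
        refine List.filter_congr fun S hS => ?_
        obtain ⟨i, hi⟩ := List.exists_mem_of_ne_nil _ S.leaves_ne_nil
        rw [Bool.eq_iff_iff]
        simp only [List.mem_filter, decide_eq_true_eq, Bool.not_eq_true', decide_eq_false_iff_not]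
        rcases h2 S hS with h | h
        · exact ⟨fun h' => absurd (h i hi) (h' i hi).2, fun h' => absurd h h'⟩
        · exact ⟨fun _ h' => h i hi (h' i hi), fun _ i hi => ⟨hSs S hS i hi, h i hi⟩⟩
      · intro S hS
        simp only [List.mem_filter, decide_eq_true_eq, not_and, not_not]
        rcases h2 S hS with h | h
        · exact Or.inr fun i hi _ => h i hi
        · exact Or.inl fun i hi => ⟨hSs S hS i hi, h i hi⟩
  simp only [triangularSubset, ← hB]
  cases hfind : B.find? (fun T => T.depth = Nat.log 2 s.length) with
  | some T =>
    have := key [T] (by simp) (by simpa using List.mem_of_find?_eq_some hfind)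
    simp only [List.flatMap_cons, List.flatMap_nil, List.append_nil] at this
    exact ⟨_, rfl, this⟩
  | none =>
    simp only [List.find?_eq_none, decide_eq_true_eq] at hfind
    have hlt : ∀ T ∈ B, T.depth < Nat.log 2 s.length := by
      intro T hT
      refine lt_of_le_of_ne (Nat.le_log_of_pow_le (by norm_num) ?_) (hfind T hT)
      rw [← hsum]
      exact List.le_sum_of_mem (List.mem_map.2 ⟨T, hT, rfl⟩)
    -- If the depths were distinct, all being below `log₂ |s|`, the tree sizes would be distinct
    -- smaller powers of two, with sum less than `2 ^ Nat.log 2 |s| ≤ |s|`. But the sizes add up to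
    -- `|s|`.
    have hrep : (B.map LTree.depth).filter
        (fun d' => 2 ≤ (B.map LTree.depth).count d') ≠ [] := by
      intro h
      have hnd' : (B.map LTree.depth).Nodup := by
        rw [List.nodup_iff_count_le_one]
        intro a
        by_contra hc
        have : a ∈ (B.map LTree.depth).filter
            (fun d' => 2 ≤ (B.map LTree.depth).count d') := by
          rw [List.mem_filter]
          exact ⟨List.count_pos_iff.1 (by omega), by simp; omega⟩
        rw [h] at this
        simp at this
      have h1 : ((B.map LTree.depth).map fun d => 2 ^ d).sum < 2 ^ Nat.log 2 s.length := by
        rw [← List.sum_toFinset _ hnd']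
        refine Nat.geomSum_lt le_rfl fun k hk => ?_
        simp only [List.mem_toFinset, List.mem_map] at hk
        obtain ⟨T, hT, rfl⟩ := hk
        exact hlt T hT
      rw [List.map_map] at h1
      have h2 := Nat.pow_log_le_self 2 (x := s.length) (by simpa using hne)
      exact absurd (hsum ▸ h1 : s.length < _) (by omega)
    obtain ⟨D, hD⟩ := Option.isSome_iff_exists.1 (List.isSome_max?_iff.2 hrep)
    have hDm : D ∈ B.map LTree.depth := (List.mem_filter.1 (List.max?_mem hD)).1
    obtain ⟨T, hT, hTD⟩ := List.mem_map.1 hDm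
    have hmemT : T ∈ (B.dropWhile (fun T => T.depth ≠ D)).rdropWhile (fun T => T.depth ≠ D) := by
      rw [List.rdropWhile, List.mem_reverse]
      refine mem_dropWhile_of_mem (List.mem_reverse.2 (mem_dropWhile_of_mem hT ?_)) ?_ <;>
        simp [hTD]
    refine ⟨_, by simp only [hD]; rfl, key _ (List.ne_nil_of_mem hmemT) fun S hS => ?_⟩
    rw [List.rdropWhile, List.mem_reverse] at hS
    exact (List.dropWhile_sublist _).subset
      (List.mem_reverse.1 ((List.dropWhile_sublist _).subset hS))

/-! ### Leftist circuits -/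

/-- With the gates `G`, the root of the full tree `T` computes the iterated `p` of the leaves. -/
structure Realizes (p : Op) (I : List ℕ) (G : List Gate) (T : LTree) : Prop where
  full : T.leaves.length = 2 ^ T.depth
  valid : T.root.Valid I G.length
  value : ∀ x, T.root.value x (gateValues x G) = bigOp p (T.leaves.map x)

theorem Realizes.append {p : Op} {I : List ℕ} {G : List Gate} {T : LTree} (h : Realizes p I G T)
    (H : List Gate) : Realizes p I (G ++ H) T where
  full := h.full
  valid := h.valid.mono (by simp)
  value x := by rw [Vertex.value_append h.valid, h.value]

theorem fullTree_spec (p : Op) {I : List ℕ} (k : ℕ) (xs : List ℕ) (G : List Gate)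
    (hxs : xs.length = 2 ^ k) (hI : ∀ i ∈ xs, i ∈ I) :
    (fullTree p k xs G.length).1.leaves = xs ∧ (fullTree p k xs G.length).1.depth = k ∧
      (fullTree p k xs G.length).2.length + 1 = 2 ^ k ∧
      GatesFrom I G.length (fullTree p k xs G.length).2 ∧
      (fullTree p k xs G.length).1.Forall (Realizes p I (G ++ (fullTree p k xs G.length).2)) := by
  induction k generalizing xs G with
  | zero =>
    obtain ⟨a, rfl⟩ := List.length_eq_one_iff.1 hxs
    refine ⟨rfl, rfl, rfl, GatesFrom.nil _ _, ⟨rfl, hI a (by simp), fun x => ?_⟩⟩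
    exact (bigOp_singleton p (x a)).symm
  | succ k ih =>
    have hpow : 2 ^ (k + 1) = 2 ^ k + 2 ^ k := by ring
    obtain ⟨l1, l2, l3, l4, l5⟩ := ih (xs.take (2 ^ k)) G (by rw [List.length_take]; omega)
      fun i hi => hI i (List.mem_of_mem_take hi)
    set L := fullTree p k (xs.take (2 ^ k)) G.length
    obtain ⟨r1, r2, r3, r4, r5⟩ := ih (xs.drop (2 ^ k)) (G ++ L.2)
      (by rw [List.length_drop]; omega) fun i hi => hI i (List.mem_of_mem_drop hi)
    set R := fullTree p k (xs.drop (2 ^ k)) (G ++ L.2).length with hR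
    have hR' : fullTree p k (xs.drop (2 ^ k)) (G.length + L.2.length) = R := by
      rw [hR, List.length_append]
    have hT : fullTree p (k + 1) xs G.length =
        (.node (G ++ L.2 ++ R.2).length L.1 R.1, L.2 ++ R.2 ++ [⟨p, L.1.root, R.1.root⟩]) := by
      rw [← hR', List.length_append, List.length_append]
      rfl
    rw [hT]
    have hG : G ++ (L.2 ++ R.2 ++ [⟨p, L.1.root, R.1.root⟩]) =
      (G ++ L.2 ++ R.2) ++ [⟨p, L.1.root, R.1.root⟩] := by simp
    have hl : L.1.Forall (Realizes p I (G ++ L.2 ++ R.2)) := l5.mono fun T h => h.append _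
    have hleaves : L.1.leaves ++ R.1.leaves = xs := by rw [l1, r1, List.take_append_drop]
    refine ⟨hleaves, by simp [LTree.depth, l2, r2], ?_, ?_, ?_, ?_, ?_⟩
    · simp only [List.length_append, List.length_singleton]; omega
    · refine (l4.append (by rwa [List.length_append] at r4)).append (GatesFrom.singleton ?_ ?_)
      · exact hl.self.valid.mono (by simp)
      · exact r5.self.valid.mono (by simp)
    · simp only [hG]
      refine ⟨?_, by simp [LTree.root, Vertex.Valid], fun x => ?_⟩
      · simp [LTree.leaves, LTree.depth, l1, r1, l2, r2, hxs]
      · change Vertex.value x _ (.gate _) = bigOp p ((L.1.leaves ++ R.1.leaves).map x)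
        rw [Vertex.value_last, hl.self.value, r5.self.value, List.map_append, bigOp_append]
    · rw [hG]; exact hl.mono fun T h => h.append _
    · rw [hG]; exact r5.mono fun T h => h.append _

theorem leftist_nil (p : Op) (g : ℕ) : leftist p [] g = ([], []) := by
  rw [leftist]; simp

theorem leftist_of_ne_nil (p : Op) {xs : List ℕ} (h : xs ≠ []) (g : ℕ) :
    leftist p xs g =
      ((fullTree p (Nat.log 2 xs.length) (xs.take (2 ^ Nat.log 2 xs.length)) g).1 ::
        (leftist p (xs.drop (2 ^ Nat.log 2 xs.length)) (g +
          (fullTree p (Nat.log 2 xs.length) (xs.take (2 ^ Nat.log 2 xs.length)) g).2.length)).1,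
      (fullTree p (Nat.log 2 xs.length) (xs.take (2 ^ Nat.log 2 xs.length)) g).2 ++
        (leftist p (xs.drop (2 ^ Nat.log 2 xs.length)) (g +
          (fullTree p (Nat.log 2 xs.length)
            (xs.take (2 ^ Nat.log 2 xs.length)) g).2.length)).2) := by
  rw [leftist, dif_neg h]

/-- A full tree has one gate less than leaves, so only the first tree's saving is kept in the gate
count. Truncated subtraction makes the bound 0 for no inputs. -/
theorem leftist_spec (p : Op) {I : List ℕ} (xs : List ℕ) (G : List Gate)
    (hI : ∀ i ∈ xs, i ∈ I) :
    (leftist p xs G.length).1.flatMap LTree.leaves = xs ∧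
      (leftist p xs G.length).2.length ≤ xs.length - 1 ∧
      GatesFrom I G.length (leftist p xs G.length).2 ∧
      ∀ T ∈ (leftist p xs G.length).1,
        T.Forall (Realizes p I (G ++ (leftist p xs G.length).2)) := by
  induction hn : xs.length using Nat.strong_induction_on generalizing xs G with
  | _ n ih =>
    by_cases hxs : xs = []
    · subst hxs
      rw [leftist_nil]
      exact ⟨rfl, Nat.zero_le _, GatesFrom.nil _ _, by simp⟩
    · have hpos : 0 < xs.length := List.length_pos_of_ne_nil hxs
      have hlog := Nat.pow_log_le_self 2 hpos.ne'
      have hk : 0 < 2 ^ Nat.log 2 xs.length := by positivity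
      rw [leftist_of_ne_nil p hxs]
      set k := Nat.log 2 xs.length
      obtain ⟨t1, t2, t3, t4, t5⟩ := fullTree_spec p k (xs.take (2 ^ k)) G
        (by rw [List.length_take]; omega) fun i hi => hI i (List.mem_of_mem_take hi)
      set T := fullTree p k (xs.take (2 ^ k)) G.length
      obtain ⟨r1, r2, r3, r4⟩ := ih (xs.drop (2 ^ k)).length
        (by rw [List.length_drop]; omega) (xs.drop (2 ^ k)) (G ++ T.2)
        (fun i hi => hI i (List.mem_of_mem_drop hi)) rfl
      rw [List.length_append] at r1 r2 r3 r4
      rw [List.length_drop] at r2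
      set R := leftist p (xs.drop (2 ^ k)) (G.length + T.2.length)
      refine ⟨?_, ?_, t4.append r3, fun S hS => ?_⟩
      · rw [List.flatMap_cons, t1, r1, List.take_append_drop]
      · simp only [List.length_append]; omega
      · rw [← List.append_assoc]
        rcases List.mem_cons.1 hS with rfl | hS
        · exact t5.mono fun T h => h.append _
        · exact r4 S hS

/-! ### Boundaries of intervals -/

/-- The elements of `xs` in `K` are those with positions in `[u, v)`. -/
def IsInterval (xs K : List ℕ) (u v : ℕ) : Prop :=
  ∀ (i : ℕ) (h : i < xs.length), xs[i] ∈ K ↔ u ≤ i ∧ i < v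

theorem IsInterval.take {xs K : List ℕ} {u v : ℕ} (h : IsInterval xs K u v) (k : ℕ) :
    IsInterval (xs.take k) K u v := by
  intro i hi
  rw [List.getElem_take]
  exact h i _

theorem IsInterval.drop {xs K : List ℕ} {u v : ℕ} (h : IsInterval xs K u v) (k : ℕ) :
    IsInterval (xs.drop k) K (u - k) (v - k) := by
  intro i hi
  rw [List.getElem_drop, h]
  omega

theorem IsInterval.mono {xs K : List ℕ} {u v u' v' : ℕ} (h : IsInterval xs K u v)
    (h' : ∀ i < xs.length, (u ≤ i ∧ i < v) ↔ (u' ≤ i ∧ i < v')) : IsInterval xs K u' v' :=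
  fun i hi => (h i hi).trans (h' i hi)

theorem leaves_fullTree (p : Op) (k : ℕ) (xs : List ℕ) (g : ℕ) (hxs : xs.length = 2 ^ k) :
    (fullTree p k xs g).1.leaves = xs := by
  -- `g` dummy gates turn an arbitrary starting number into the length of a gate list.
  simpa using (fullTree_spec p k xs (List.replicate g ⟨p, .input 0, .input 0⟩) hxs
    fun i hi => hi).1

section Intervals

variable {p : Op} {K : List ℕ}

theorem boundary_fullTree_of_disjoint {k : ℕ} {xs : List ℕ} {g u v : ℕ} (hxs : xs.length = 2 ^ k)
    (h : IsInterval xs K u v) (huv : ∀ i < 2 ^ k, ¬(u ≤ i ∧ i < v)) :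
    (fullTree p k xs g).1.boundary K = [] := by
  refine LTree.boundary_eq_nil fun i hi => ?_
  rw [leaves_fullTree _ _ _ _ hxs] at hi
  obtain ⟨j, hj, rfl⟩ := List.getElem_of_mem hi
  rw [h j hj]
  exact huv j (by omega)

theorem boundary_fullTree_of_subset {k : ℕ} {xs : List ℕ} {g u v : ℕ} (hxs : xs.length = 2 ^ k)
    (h : IsInterval xs K u v) (huv : ∀ i < 2 ^ k, u ≤ i ∧ i < v) :
    (fullTree p k xs g).1.boundary K = [(fullTree p k xs g).1] := by
  refine LTree.boundary_eq_self fun i hi => ?_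
  rw [leaves_fullTree _ _ _ _ hxs] at hi
  obtain ⟨j, hj, rfl⟩ := List.getElem_of_mem hi
  rw [h j hj]
  exact huv j (by omega)

theorem boundary_fullTree_succ {k : ℕ} {xs : List ℕ} {g u v i₀ : ℕ} (hxs : xs.length = 2 ^ (k + 1))
    (h : IsInterval xs K u v) (hi₀ : i₀ < 2 ^ (k + 1)) (huv : ¬(u ≤ i₀ ∧ i₀ < v)) :
    ∃ g₁ g₂, (fullTree p (k + 1) xs g).1.boundary K =
      (fullTree p k (xs.take (2 ^ k)) g₁).1.boundary K ++
        (fullTree p k (xs.drop (2 ^ k)) g₂).1.boundary K := by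
  refine ⟨g, g + (fullTree p k (xs.take (2 ^ k)) g).2.length, ?_⟩
  have hl := leaves_fullTree p (k + 1) xs g hxs
  rw [fullTree] at hl ⊢
  simp only at hl ⊢
  rw [LTree.boundary, if_neg]
  intro h'
  rw [hl] at h'
  exact huv ((h i₀ (by omega)).1 (h' _ (List.getElem_mem _)))

/-- The boundary trees of a proper prefix correspond to the binary ones of `v`, and a number with
`b` ones is at least `2^b - 1`. -/
theorem boundary_fullTree_prefix {k : ℕ} {xs : List ℕ} {g v : ℕ} (hxs : xs.length = 2 ^ k)
    (h : IsInterval xs K 0 v) (hv : v < 2 ^ k) :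
    2 ^ ((fullTree p k xs g).1.boundary K).length ≤ v + 1 := by
  induction k generalizing xs g v with
  | zero =>
    rw [boundary_fullTree_of_disjoint hxs h (by omega)]
    simp
  | succ k ih =>
    have hpow : 2 ^ (k + 1) = 2 ^ k + 2 ^ k := by ring
    obtain ⟨g₁, g₂, hb⟩ := boundary_fullTree_succ (p := p) (g := g) hxs h hv (by simp)
    have ht : (xs.take (2 ^ k)).length = 2 ^ k := by rw [List.length_take]; omega
    have hd : (xs.drop (2 ^ k)).length = 2 ^ k := by rw [List.length_drop]; omega
    rw [hb, List.length_append]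
    rcases lt_or_ge v (2 ^ k) with hvk | hvk
    · rw [boundary_fullTree_of_disjoint hd (h.drop _) (by omega)]
      exact ih ht (h.take _) hvk
    · rw [boundary_fullTree_of_subset ht (h.take _) (by omega)]
      have := ih (g := g₂) hd ((h.drop (2 ^ k)).mono (by omega)) (by omega : v - 2 ^ k < 2 ^ k)
      rw [List.length_singleton, pow_add]
      omega

/-- Mirror image of the prefix case, for a suffix of length `2^k - u`. -/
theorem boundary_fullTree_suffix {k : ℕ} {xs : List ℕ} {g u v : ℕ} (hxs : xs.length = 2 ^ k)
    (h : IsInterval xs K u v) (hu : 0 < u) (huk : u ≤ 2 ^ k) (hv : 2 ^ k ≤ v) :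
    2 ^ ((fullTree p k xs g).1.boundary K).length ≤ 2 ^ k - u + 1 := by
  induction k generalizing xs g u v with
  | zero =>
    rw [boundary_fullTree_of_disjoint hxs h (by omega)]
    simp
  | succ k ih =>
    have hpow : 2 ^ (k + 1) = 2 ^ k + 2 ^ k := by ring
    obtain ⟨g₁, g₂, hb⟩ := boundary_fullTree_succ (p := p) (g := g) (i₀ := 0) hxs h (by omega)
      (by omega)
    have ht : (xs.take (2 ^ k)).length = 2 ^ k := by rw [List.length_take]; omega
    have hd : (xs.drop (2 ^ k)).length = 2 ^ k := by rw [List.length_drop]; omega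
    rw [hb, List.length_append]
    rcases lt_or_ge (2 ^ k) u with hvk | hvk
    · rw [boundary_fullTree_of_disjoint ht (h.take _) (by omega)]
      have := ih (g := g₂) hd (h.drop (2 ^ k)) (by omega) (by omega) (by omega)
      rw [List.length_nil, zero_add]
      omega
    · rw [boundary_fullTree_of_subset hd (h.drop _) (by omega)]
      have := ih (g := g₁) ht (h.take _) hu hvk (by omega)
      rw [List.length_singleton, pow_add]
      omega

/-- At the node whose two halves both meet the interval, it is a suffix of the left half and a
prefix of the right half, which contribute `a` and `b`. -/
theorem boundary_fullTree_interval {k : ℕ} {xs : List ℕ} {g u v : ℕ} (hxs : xs.length = 2 ^ k)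
    (h : IsInterval xs K u v) (huv : u ≤ v) (hv : v ≤ 2 ^ k) :
    ∃ a b, ((fullTree p k xs g).1.boundary K).length = a + b ∧ 2 ^ a + 2 ^ b ≤ v - u + 2 := by
  have hpos : 0 < 2 ^ k := by positivity
  rcases Nat.eq_zero_or_pos u with rfl | hu
  · rcases hv.lt_or_eq with hv | rfl
    · have := boundary_fullTree_prefix (p := p) (g := g) hxs h hv
      exact ⟨_, 0, rfl, by omega⟩
    · rw [boundary_fullTree_of_subset hxs h (by omega)]
      exact ⟨1, 0, rfl, by omega⟩
  rcases hv.lt_or_eq with hv | rfl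
  · induction k generalizing xs g u v with
    | zero => omega
    | succ k ih =>
      have hpow : 2 ^ (k + 1) = 2 ^ k + 2 ^ k := by ring
      obtain ⟨g₁, g₂, hb⟩ := boundary_fullTree_succ (p := p) (g := g) hxs h hv (by omega)
      have ht : (xs.take (2 ^ k)).length = 2 ^ k := by rw [List.length_take]; omega
      have hd : (xs.drop (2 ^ k)).length = 2 ^ k := by rw [List.length_drop]; omega
      rw [hb, List.length_append]
      rcases lt_or_ge v (2 ^ k) with hvk | hvk
      · rw [boundary_fullTree_of_disjoint hd (h.drop _) (by omega)]
        exact ih ht (h.take _) huv hvk.le (by positivity) hu hvk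
      rcases lt_or_ge u (2 ^ k) with huk | huk
      · have h1 := boundary_fullTree_suffix (p := p) (g := g₁) ht (h.take _) hu huk.le hvk
        have h2 := boundary_fullTree_prefix (p := p) (g := g₂) hd
          ((h.drop (2 ^ k)).mono (by omega)) (by omega : v - 2 ^ k < 2 ^ k)
        exact ⟨_, _, rfl, by omega⟩
      · rw [boundary_fullTree_of_disjoint ht (h.take _) (by omega)]
        rcases huk.eq_or_lt with rfl | huk
        · have := boundary_fullTree_prefix (p := p) (g := g₂) hd
            ((h.drop (2 ^ k)).mono (by omega)) (by omega : v - 2 ^ k < 2 ^ k)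
          exact ⟨0, _, rfl, by omega⟩
        · obtain ⟨a, b, hab, h'⟩ := ih (g := g₂) hd (h.drop (2 ^ k)) (by omega) (by omega)
            (by positivity) (by omega) (by omega)
          exact ⟨a, b, by simpa using hab, by omega⟩
  · have := boundary_fullTree_suffix (p := p) (g := g) hxs h hu huv le_rfl
    exact ⟨_, 0, rfl, by omega⟩

/-- As in a full tree: by maximality of `k` the list is shorter than `2^(k+1)`, so using up the
first tree at least halves `v + 1`. -/
theorem boundarySeq_leftist_prefix {xs : List ℕ} {g v : ℕ} (h : IsInterval xs K 0 v)
    (hv : v ≤ xs.length) :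
    2 ^ (boundarySeq (leftist p xs g).1 K).length ≤ v + 1 := by
  induction hn : xs.length using Nat.strong_induction_on generalizing xs g v with
  | _ n ih =>
    by_cases hxs : xs = []
    · subst hxs
      simp [leftist_nil, boundarySeq]
    · have hpos : 0 < xs.length := List.length_pos_of_ne_nil hxs
      have hlog := Nat.pow_log_le_self 2 hpos.ne'
      have hlog' := Nat.lt_pow_succ_log_self one_lt_two xs.length
      rw [leftist_of_ne_nil p hxs]
      set k := Nat.log 2 xs.length
      have hk : 0 < 2 ^ k := by positivity
      have hpow : 2 ^ (k + 1) = 2 ^ k + 2 ^ k := by ring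
      rw [Nat.succ_eq_add_one] at hlog'
      set g' := g + (fullTree p k (xs.take (2 ^ k)) g).2.length
      have ht : (xs.take (2 ^ k)).length = 2 ^ k := by rw [List.length_take]; omega
      have hd : (xs.drop (2 ^ k)).length = xs.length - 2 ^ k := List.length_drop
      have hr := ih (xs.drop (2 ^ k)).length (by omega) (g := g')
        ((h.drop (2 ^ k)).mono (by omega)) (by omega : v - 2 ^ k ≤ _) rfl
      simp only [boundarySeq, List.flatMap_cons, List.length_append] at hr ⊢
      rw [pow_add]
      rcases lt_or_ge v (2 ^ k) with hvk | hvk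
      · have := boundary_fullTree_prefix (p := p) (g := g) ht (h.take _) hvk
        rw [Nat.sub_eq_zero_of_le hvk.le] at hr
        simpa using Nat.mul_le_mul this hr
      · rw [boundary_fullTree_of_subset ht (h.take _) (by omega), List.length_singleton]
        omega

theorem boundarySeq_leftist_of_disjoint {xs : List ℕ} {g u v : ℕ} (h : IsInterval xs K u v)
    (huv : ∀ i < xs.length, ¬(u ≤ i ∧ i < v)) : boundarySeq (leftist p xs g).1 K = [] := by
  have := boundarySeq_leftist_prefix (p := p) (g := g) (h.mono (v' := 0) (u' := 0)
    fun i hi => ⟨fun h => absurd h (huv i hi), by omega⟩) (Nat.zero_le _)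
  by_contra hne
  have h2 := List.length_pos_of_ne_nil hne
  have h3 := Nat.lt_two_pow_self (n := (boundarySeq (leftist p xs g).1 K).length)
  omega

theorem exists_length_boundarySeq_leftist {xs : List ℕ} {g u v : ℕ} (h : IsInterval xs K u v)
    (huv : u ≤ v) (hv : v ≤ xs.length) :
    ∃ a b, (boundarySeq (leftist p xs g).1 K).length = a + b ∧ 2 ^ a + 2 ^ b ≤ v - u + 2 := by
  induction hn : xs.length using Nat.strong_induction_on generalizing xs g u v with
  | _ n ih =>
    rcases Nat.eq_zero_or_pos u with rfl | hu
    · have := boundarySeq_leftist_prefix (p := p) (g := g) h hv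
      exact ⟨_, 0, rfl, by omega⟩
    by_cases hxs : xs = []
    · subst hxs
      exact ⟨0, 0, by simp [leftist_nil, boundarySeq], by omega⟩
    · have hpos : 0 < xs.length := List.length_pos_of_ne_nil hxs
      have hlog := Nat.pow_log_le_self 2 hpos.ne'
      rw [leftist_of_ne_nil p hxs]
      set k := Nat.log 2 xs.length
      have hk : 0 < 2 ^ k := by positivity
      set g' := g + (fullTree p k (xs.take (2 ^ k)) g).2.length
      have ht : (xs.take (2 ^ k)).length = 2 ^ k := by rw [List.length_take]; omega
      have hd : (xs.drop (2 ^ k)).length = xs.length - 2 ^ k := List.length_drop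
      rw [boundarySeq, List.flatMap_cons, List.length_append]
      change ∃ a b, _ + (boundarySeq (leftist p (xs.drop (2 ^ k)) g').1 K).length = _ ∧ _
      rcases lt_or_ge (2 ^ k) v with hvk | hvk
      · rcases lt_or_ge u (2 ^ k) with huk | huk
        · have h1 := boundary_fullTree_suffix (p := p) (g := g) ht (h.take _) hu huk.le hvk.le
          have h2 := boundarySeq_leftist_prefix (p := p) (g := g')
            ((h.drop (2 ^ k)).mono (by omega)) (by omega : v - 2 ^ k ≤ _)
          exact ⟨_, _, rfl, by omega⟩
        · rw [boundary_fullTree_of_disjoint ht (h.take _) (by omega)]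
          obtain ⟨a, b, hab, h'⟩ := ih (xs.drop (2 ^ k)).length (by omega) (g := g')
            (h.drop (2 ^ k)) (by omega) (by omega) rfl
          exact ⟨a, b, by simpa using hab, by omega⟩
      · rw [boundarySeq_leftist_of_disjoint (h.drop (2 ^ k)) (by omega)]
        simpa using boundary_fullTree_interval (p := p) (g := g) ht (h.take _) huv hvk

/-- By the inequality of arithmetic and geometric means, `4 · 2^a · 2^b ≤ (2^a + 2^b)²`. -/
theorem pow_length_boundarySeq_leftist_le {xs : List ℕ} {g u v : ℕ} (h : IsInterval xs K u v)
    (huv : u ≤ v) (hv : v ≤ xs.length) :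
    2 ^ ((boundarySeq (leftist p xs g).1 K).length + 2) ≤ (v - u + 2) ^ 2 := by
  obtain ⟨a, b, hab, h'⟩ := exists_length_boundarySeq_leftist (p := p) (g := g) h huv hv
  rw [hab]
  calc 2 ^ (a + b + 2) = 4 * (2 ^ a * 2 ^ b) := by ring
    _ ≤ (2 ^ a + 2 ^ b) ^ 2 := by
      simpa only [mul_assoc] using four_mul_le_sq_add (2 ^ a) (2 ^ b)
    _ ≤ _ := Nat.pow_le_pow_left h' 2

end Intervals

/-! ### Properties of `μ` and `d_min` -/

section Numerics

variable {ξ : ℝ}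

theorem mu_antitone (hξ : 0 ≤ ξ) (d : ℕ) {n n' : ℕ} (h : n ≤ n') : mu ξ d n' ≤ mu ξ d n := by
  unfold mu
  gcongr

theorem mu_zero_le_succ (hξ : 0 ≤ ξ) {d : ℕ} (hd : 1 ≤ d) : mu ξ d 0 ≤ mu ξ (d + 1) 0 := by
  unfold mu
  have hd' : (1 : ℝ) ≤ d := by exact_mod_cast hd
  have h2 : (0 : ℝ) < 2 ^ d := by positivity
  have : ((2 : ℝ) ^ d - (0 : ℕ) - 2) / d ≤ (2 ^ (d + 1) - (0 : ℕ) - 2) / (d + 1 : ℕ) := by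
    rw [div_le_div_iff₀ (by positivity) (by positivity)]
    push_cast
    rw [pow_succ]
    nlinarith
  rw [mul_div_assoc, mul_div_assoc]
  gcongr

theorem mu_zero_mono (hξ : 0 ≤ ξ) {d d' : ℕ} (hd : 1 ≤ d) (h : d ≤ d') :
    mu ξ d 0 ≤ mu ξ d' 0 := by
  induction d', h using Nat.le_induction with
  | base => exact le_rfl
  | succ e he ih => exact ih.trans (mu_zero_le_succ hξ (hd.trans he))

theorem sq_le_two_pow {d : ℕ} (hd : 4 ≤ d) : d ^ 2 ≤ 2 ^ d := by
  induction d, hd using Nat.le_induction with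
  | base => norm_num
  | succ e he ih => rw [pow_succ 2 e]; nlinarith

theorem exists_le_mu (hξ : 1 ≤ ξ) (n m : ℕ) : ∃ d, 1 ≤ d ∧ (m : ℝ) ≤ mu ξ d n := by
  refine ⟨n + m + 4, by omega, ?_⟩
  set d := n + m + 4 with hd
  have h1 : d ^ 2 ≤ 2 ^ d := sq_le_two_pow (by omega)
  have h1' : (d : ℝ) ^ 2 ≤ 2 ^ d := by exact_mod_cast h1
  have hd' : (d : ℝ) = n + m + 4 := by rw [hd]; push_cast; ring
  have hn : (0 : ℝ) ≤ n := by positivity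
  have hm : (0 : ℝ) ≤ m := by positivity
  have hdpos : (0 : ℝ) < d := by rw [hd']; positivity
  have h2 : (m : ℝ) * d ≤ 2 ^ d - n - 2 := by nlinarith
  have h3 : (m : ℝ) ≤ (2 ^ d - n - 2) / d := by rwa [le_div_iff₀ hdpos]
  unfold mu
  rw [mul_div_assoc]
  nlinarith

theorem dMin_spec (hξ : 1 ≤ ξ) (n m : ℕ) :
    1 ≤ dMin ξ n m ∧ (m : ℝ) ≤ mu ξ (dMin ξ n m) n :=
  Nat.sInf_mem (exists_le_mu hξ n m)

theorem mu_lt_of_lt_dMin {n m d : ℕ} (hd : 1 ≤ d) (h : d < dMin ξ n m) : mu ξ d n < m := by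
  by_contra hc
  exact Nat.notMem_of_lt_sInf h ⟨hd, not_lt.1 hc⟩

/-- Makes the odd prefix of an alternating split exist: its length is at least 1. -/
theorem one_le_mu (hξ : 0 ≤ ξ) (hξ' : ξ < 2) {d n : ℕ} (hd : 3 ≤ d) (hn : n < 2 ^ d) :
    1 ≤ mu ξ d n := by
  have hn' : (n : ℝ) + 1 ≤ 2 ^ d := by exact_mod_cast hn
  have hd' : (3 : ℝ) ≤ d := by exact_mod_cast hd
  have h : -(1 : ℝ) / 2 ≤ (2 ^ d - n - 2) / d := by
    rw [div_le_div_iff₀ (by norm_num) (by linarith)]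
    nlinarith
  unfold mu
  rw [mul_div_assoc]
  nlinarith

theorem oddFloor_spec {x : ℝ} (hx : 1 ≤ x) :
    Odd (oddFloor x) ∧ (oddFloor x : ℝ) ≤ x ∧ x < oddFloor x + 2 := by
  have h1 : 1 ≤ ⌊x⌋₊ := by simpa using Nat.floor_mono hx
  have h2 := Nat.floor_le (zero_le_one.trans hx)
  have h3 := Nat.lt_floor_add_one x
  unfold oddFloor
  split
  · next h => exact ⟨h, h2, by linarith⟩
  · next h =>
    rw [Nat.not_odd_iff_even] at h
    refine ⟨Nat.Even.sub_odd h1 h odd_one, ?_⟩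
    rw [Nat.cast_sub h1]
    constructor <;> push_cast <;> linarith

/-- In an alternating split at depth `d + 1`, at most `μ(d, 0)` inputs remain outside the
prefix. -/
theorem mu_succ_sub_le (hξ : 1 ≤ ξ) (hξ' : ξ < 2) {d n m : ℕ} (hd : 3 ≤ d) (hn : n < 2 ^ d)
    (h1 : mu ξ d 0 < m) (h2 : (m : ℝ) ≤ mu ξ (d + 1) n) :
    mu ξ (d + 1) n - mu ξ d n + 2 ≤ mu ξ d 0 := by
  -- After clearing denominators, the claim is exactly this inequality; the summands 2 in the
  -- definition of `mu` balance.
  have key : 2 * ((d : ℝ) + 1) ≤ 2 ^ (d + 1) - n - 2 := by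
    rcases hd.eq_or_lt with rfl | hd
    · have h : (mu ξ 3 0) < mu ξ 4 n := h1.trans_le h2
      unfold mu at h
      norm_num at h
      have : (n : ℝ) < 7 := by
        by_contra hc
        nlinarith
      have : n < 7 := by exact_mod_cast this
      have hn6 : (n : ℝ) ≤ 6 := by exact_mod_cast (by omega : n ≤ 6)
      norm_num
      linarith
    · have h3 : 2 * d + 3 ≤ 2 ^ d := by
        have : 4 ≤ d := hd
        clear * - this
        induction d, this using Nat.le_induction with
        | base => norm_num
        | succ e he ih => rw [pow_succ]; omega
      have h3' : 2 * (d : ℝ) + 3 ≤ 2 ^ d := by exact_mod_cast h3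
      have hn' : (n : ℝ) + 1 ≤ 2 ^ d := by exact_mod_cast hn
      rw [pow_succ]
      linarith
  have hd' : (3 : ℝ) ≤ d := by exact_mod_cast hd
  have h : ((2 : ℝ) ^ (d + 1) - n - 2) / (d + 1 : ℕ) ≤
      (2 ^ d - n - 2) / d + (2 ^ d - (0 : ℕ) - 2) / d := by
    rw [← add_div, div_le_div_iff₀ (by positivity) (by linarith)]
    push_cast
    rw [pow_succ] at key ⊢
    nlinarith
  unfold mu
  rw [mul_div_assoc, mul_div_assoc, mul_div_assoc]
  nlinarith

/-! ### The bound on the number of additional gates -/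

/-- The bound on the number of additional gates for `m ≤ 13` alternating inputs. -/
def smallBound (m : ℕ) : ℕ := [0, 0, 1, 2, 3, 5, 8, 9, 10, 13, 14, 16, 17, 20].getD m 0

/-- The bound on the number of additional gates per alternating input at depth `d ≥ 6`. -/
def rate (d : ℕ) : ℝ :=
  if d ≤ 6 then 25 / 14 else if d = 7 then 2.047 else if d = 8 then 2.2313
  else if d = 9 then 2.3677 else 2.67 - 1.1 * (2 * d ^ 2 - d + 1) / 2 ^ d

/-- The bound on the number of additional gates, up to the number of boundary vertices of the
symmetric inputs, for `m ≤ μ(d, 0)` alternating inputs. -/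
def bound (d m : ℕ) : ℝ := if d ≤ 5 then smallBound m else rate d * m

theorem rate_of_ge_ten {d : ℕ} (hd : 10 ≤ d) :
    rate d = 2.67 - 1.1 * (2 * d ^ 2 - d + 1) / 2 ^ d := by
  unfold rate
  rw [if_neg (by omega), if_neg (by omega), if_neg (by omega), if_neg (by omega)]

/-- The polynomial `2 d² - d + 1` is chosen so that the increment is a multiple of `(2 d - 5) d /
2^d`, the factor `2 d - 5` being an upper bound for `c + 1`. -/
theorem rate_succ_sub_rate {d : ℕ} (hd : 10 ≤ d) :
    rate (d + 1) - rate d = 1.1 * ((2 * d - 5) * d) / 2 ^ (d + 1) := by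
  rw [rate_of_ge_ten hd, rate_of_ge_ten (by omega), pow_succ]
  have : (2 : ℝ) ^ d ≠ 0 := by positivity
  field_simp
  push_cast
  ring

theorem rate_le (d : ℕ) : rate d ≤ 2.67 := by
  unfold rate
  split_ifs
  · norm_num
  · norm_num
  · norm_num
  · norm_num
  · have : (0 : ℝ) ≤ 1.1 * (2 * (d : ℝ) ^ 2 - d + 1) / 2 ^ d := by
      have : 0 ≤ 2 * (d : ℝ) ^ 2 - d + 1 := by nlinarith [sq_nonneg ((d : ℝ) - 1)]
      exact div_nonneg (by linarith) (by positivity)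
    linarith

theorem rate_le_succ (d : ℕ) : rate d ≤ rate (d + 1) := by
  rcases lt_or_ge d 10 with h | h
  · interval_cases d <;> norm_num [rate]
  · have h1 := rate_succ_sub_rate h
    have h2 : (10 : ℝ) ≤ d := by exact_mod_cast h
    have : (0 : ℝ) ≤ 1.1 * ((2 * d - 5) * d) / 2 ^ (d + 1) := by
      exact div_nonneg (by nlinarith) (by positivity)
    linarith

theorem smallBound_le (m : ℕ) : (smallBound m : ℝ) ≤ 25 / 14 * m := by
  rcases lt_or_ge m 14 with h | h
  · interval_cases m <;> norm_num [smallBound]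
  · have : smallBound m = 0 := List.getD_eq_default _ _ h
    rw [this, Nat.cast_zero]
    positivity

theorem bound_le_succ (d m : ℕ) : bound d m ≤ bound (d + 1) m := by
  unfold bound
  rcases lt_trichotomy d 5 with h | rfl | h
  · rw [if_pos (by omega), if_pos (by omega)]
  · rw [if_pos (by omega), if_neg (by omega)]
    exact smallBound_le m
  · rw [if_neg (by omega), if_neg (by omega)]
    exact mul_le_mul_of_nonneg_right (rate_le_succ d) (by positivity)

theorem bound_mono {d d' : ℕ} (h : d ≤ d') (m : ℕ) : bound d m ≤ bound d' m := by
  induction d', h using Nat.le_induction with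
  | base => exact le_rfl
  | succ e he ih => exact ih.trans (bound_le_succ e m)

theorem bound_le (d m : ℕ) : bound d m ≤ 2.67 * m := by
  unfold bound
  have hm : (0 : ℝ) ≤ m := by positivity
  split
  · exact (smallBound_le m).trans (by nlinarith)
  · exact mul_le_mul_of_nonneg_right (rate_le d) hm

/-! ### The cost of an alternating split -/

/-- The table entries for 6 to 8, and likewise for 9 to 13 in the next lemma, are the maxima of the
left-hand side over the admitted splits. -/
theorem smallBound_add_add_le_of_lt_six : ∀ k < 6, ∀ r < 6, ∀ c < 4,
    (k % 2 = 1 ∧ 6 ≤ k + r ∧ k + r ≤ 8 ∧ 2 ^ (c + 4) ≤ (k + 3) ^ 2) →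
    smallBound k + smallBound r + 1 + c ≤ smallBound (k + r) := by
  decide

theorem smallBound_add_add_le_of_lt_nine : ∀ k < 9, ∀ r < 9, ∀ c < 4,
    (k % 2 = 1 ∧ 9 ≤ k + r ∧ k + r ≤ 13 ∧ 2 ^ (c + 4) ≤ (k + 3) ^ 2) →
    smallBound k + smallBound r + 1 + c ≤ smallBound (k + r) := by
  decide

/-- Equality for `k = 13`, `r = 1`, `c = 4`: this is the origin of the rate `25 / 14`. -/
theorem smallBound_add_add_le_mul : ∀ k < 14, ∀ r < 14, ∀ c < 5,
    (k % 2 = 1 ∧ 1 ≤ r ∧ 14 ≤ k + r ∧ 2 ^ (c + 4) ≤ (k + 3) ^ 2) →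
    14 * (smallBound k + smallBound r + 1 + c) ≤ 25 * (k + r) := by
  decide

theorem le_of_pow_add_four_le {c k K C : ℕ} (hc : 2 ^ (c + 4) ≤ (k + 3) ^ 2) (hk : k ≤ K)
    (hK : (K + 3) ^ 2 < 2 ^ (C + 5)) : c ≤ C := by
  have h1 : (k + 3) ^ 2 ≤ (K + 3) ^ 2 := Nat.pow_le_pow_left (by omega) 2
  have h2 := (Nat.pow_lt_pow_iff_right (by norm_num : 1 < 2)).1 ((hc.trans h1).trans_lt hK)
  omega

/-- Passing from level `d` to `d + 1` raises the rate on all `k + r > μ(d, 0)` inputs, and this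
increase pays for the `1 + c` extra gates of the split. -/
theorem bound_add_add_le (hξ : 1.9961 ≤ ξ) (hξ' : ξ < 2) {d k r c : ℕ} (hd : 3 ≤ d)
    (hk : Odd k) (hr : 1 ≤ r) (hk' : (k : ℝ) ≤ mu ξ d 0) (hr' : (r : ℝ) ≤ mu ξ d 0)
    (hm : mu ξ d 0 < (k + r : ℕ)) (hm' : ((k + r : ℕ) : ℝ) ≤ mu ξ (d + 1) 0)
    (hc : 2 ^ (c + 4) ≤ (k + 3) ^ 2) :
    bound d k + bound d r + 1 + c ≤ bound (d + 1) (k + r) := by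
  have hk2 := Nat.odd_iff.1 hk
  -- `K` bounds `k` from above, `M` bounds `k + r` from below and `C` bounds `c` from above.
  have step : ∀ {K M C : ℕ}, 6 ≤ d → mu ξ d 0 < (K + 1 : ℕ) → ((M - 1 : ℕ) : ℝ) ≤ mu ξ d 0 →
      (K + 3) ^ 2 < 2 ^ (C + 5) → (1 : ℝ) + C ≤ (rate (d + 1) - rate d) * M →
      bound d k + bound d r + 1 + c ≤ bound (d + 1) (k + r) := by
    intro K M C hd6 hK hM hC hrate
    have h1 : k ≤ K := Nat.lt_succ_iff.1 (by exact_mod_cast hk'.trans_lt hK)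
    have h2 : M ≤ k + r := by
      have : M - 1 < k + r := by exact_mod_cast hM.trans_lt hm
      omega
    have h3 : (c : ℝ) ≤ C := by exact_mod_cast le_of_pow_add_four_le hc h1 hC
    have h4 : (M : ℝ) ≤ k + r := by exact_mod_cast h2
    have h5 := rate_le_succ d
    unfold bound
    rw [if_neg (by omega), if_neg (by omega), if_neg (by omega)]
    push_cast
    nlinarith
  rcases lt_or_ge d 10 with h | h
  · interval_cases d
    · have e3 : mu ξ 3 0 < 6 := by norm_num [mu]; linarith
      have e3' : 5 < mu ξ 3 0 := by norm_num [mu]; linarith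
      have e4 : mu ξ 4 0 < 9 := by norm_num [mu]; linarith
      have h1 : k < 6 := by exact_mod_cast hk'.trans_lt e3
      have h2 : r < 6 := by exact_mod_cast hr'.trans_lt e3
      have h3 : 5 < k + r := by exact_mod_cast e3'.trans hm
      have h4 : k + r < 9 := by exact_mod_cast hm'.trans_lt e4
      have h5 : c ≤ 3 := le_of_pow_add_four_le hc (K := 5) (by omega) (by norm_num)
      have := smallBound_add_add_le_of_lt_six k (by omega) r (by omega) c (by omega)
        ⟨hk2, by omega, by omega, hc⟩
      norm_num [bound]
      exact_mod_cast this
    · have e3 : mu ξ 4 0 < 9 := by norm_num [mu]; linarith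
      have e3' : 8 < mu ξ 4 0 := by norm_num [mu]; linarith
      have e4 : mu ξ 5 0 < 14 := by norm_num [mu]; linarith
      have h1 : k < 9 := by exact_mod_cast hk'.trans_lt e3
      have h2 : r < 9 := by exact_mod_cast hr'.trans_lt e3
      have h3 : 8 < k + r := by exact_mod_cast e3'.trans hm
      have h4 : k + r < 14 := by exact_mod_cast hm'.trans_lt e4
      have h5 : c ≤ 3 := le_of_pow_add_four_le hc (K := 8) (by omega) (by norm_num)
      have := smallBound_add_add_le_of_lt_nine k (by omega) r (by omega) c (by omega)
        ⟨hk2, by omega, by omega, hc⟩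
      norm_num [bound]
      exact_mod_cast this
    · have e3 : mu ξ 5 0 < 14 := by norm_num [mu]; linarith
      have e3' : 13 < mu ξ 5 0 := by norm_num [mu]; linarith
      have h1 : k < 14 := by exact_mod_cast hk'.trans_lt e3
      have h2 : r < 14 := by exact_mod_cast hr'.trans_lt e3
      have h3 : 13 < k + r := by exact_mod_cast e3'.trans hm
      have h5 : c ≤ 4 := le_of_pow_add_four_le hc (K := 13) (by omega) (by norm_num)
      have := smallBound_add_add_le_mul k h1 r h2 c (by omega) ⟨hk2, hr, by omega, hc⟩
      have h6 : (14 * (smallBound k + smallBound r + 1 + c) : ℝ) ≤ 25 * (k + r) := by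
        exact_mod_cast this
      norm_num [bound, rate]
      linarith
    -- For `6 ≤ d ≤ 9`, `K = ⌊μ(d, 0)⌋` for every admitted `ξ`, `M = K + 1`, and `C` is the least
    -- value with `(K + 3)² < 2^(C + 5)`.
    · exact step (K := 22) (M := 23) (C := 5) (by norm_num) (by norm_num [mu]; linarith)
        (by norm_num [mu]; linarith) (by norm_num) (by norm_num [rate])
    · exact step (K := 37) (M := 38) (C := 6) (by norm_num) (by norm_num [mu]; linarith)
        (by norm_num [mu]; linarith) (by norm_num) (by norm_num [rate])
    · exact step (K := 65) (M := 66) (C := 8) (by norm_num) (by norm_num [mu]; linarith)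
        (by norm_num [mu]; linarith) (by norm_num) (by norm_num [rate])
    · exact step (K := 115) (M := 116) (C := 9) (by norm_num) (by norm_num [mu]; linarith)
        (by norm_num [mu]; linarith) (by norm_num) (by norm_num [rate])
  · have hd' : (10 : ℝ) ≤ d := by exact_mod_cast h
    have hX : (1024 : ℝ) ≤ 2 ^ d := by
      calc (1024 : ℝ) = 2 ^ 10 := by norm_num
        _ ≤ 2 ^ d := pow_le_pow_right₀ (by norm_num) h
    have hmu : mu ξ d 0 = ξ * ((2 ^ d - 2) / d) + 2 := by unfold mu; push_cast; ring
    have hq : ((2 : ℝ) ^ d - 2) / d ≤ 2 ^ d / 10 := by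
      rw [div_le_div_iff₀ (by linarith) (by norm_num)]
      nlinarith
    have hq0 : (0 : ℝ) ≤ (2 ^ d - 2) / d := div_nonneg (by linarith) (by linarith)
    -- Here `k ≤ μ(d, 0) ≤ 2^d / 5 + 2` and `2^d ≥ 1024`. This gives `c + 1 ≤ 2 d - 5` below.
    have hkX : ((k + 3 : ℕ) : ℝ) ≤ 2 ^ (d - 1 : ℕ) := by
      have : (2 : ℝ) ^ d = 2 * 2 ^ (d - 1) := by
        rw [← pow_succ']; congr 1; omega
      push_cast
      nlinarith
    have hkN : k + 3 ≤ 2 ^ (d - 1) := by exact_mod_cast hkX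
    have hc' : c + 4 ≤ 2 * (d - 1) := by
      have := Nat.pow_le_pow_left hkN 2
      rw [← pow_mul] at this
      have := (Nat.pow_le_pow_iff_right (by norm_num : 1 < 2)).1 (hc.trans this)
      omega
    have hcR : (c : ℝ) + 1 ≤ 2 * d - 5 := by
      have : c + 6 ≤ 2 * d := by omega
      have : (c : ℝ) + 6 ≤ 2 * d := by exact_mod_cast this
      linarith
    -- The summand 2 of `mu` absorbs the loss `2 ξ / d`.
    have hmlow : 1.9961 * (2 ^ d / d) ≤ ((k + r : ℕ) : ℝ) := by
      refine le_trans ?_ hm.le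
      rw [hmu, sub_div]
      have h2d : (2 : ℝ) / d ≤ 2 / 10 := div_le_div_of_nonneg_left (by norm_num) (by norm_num) hd'
      rw [sub_div] at hq0
      nlinarith
    -- The factor 1.1 in `rate` serves to make `1.1 * 1.9961 / 2` at least 1.
    have hstep : (2 * (d : ℝ) - 5) ≤ (rate (d + 1) - rate d) * (1.9961 * (2 ^ d / d)) := by
      rw [rate_succ_sub_rate h, pow_succ]
      have e : 1.1 * ((2 * (d : ℝ) - 5) * d) / (2 ^ d * 2) * (1.9961 * (2 ^ d / d)) =
          (1.1 * 1.9961 / 2) * (2 * (d : ℝ) - 5) := by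
        field_simp
      rw [e]
      nlinarith
    have h5 := rate_le_succ d
    have h6 : (rate (d + 1) - rate d) * (1.9961 * (2 ^ d / d)) ≤
        (rate (d + 1) - rate d) * ((k + r : ℕ) : ℝ) :=
      mul_le_mul_of_nonneg_left hmlow (by linarith)
    unfold bound
    rw [if_neg (by omega), if_neg (by omega), if_neg (by omega)]
    push_cast at h6 ⊢
    nlinarith

end Numerics

/-! ### The leftist circuits on the even and the odd global inputs -/

def Op.parity : Op → ℕ
  | .and => 0
  | .or => 1

theorem Op.parity_dual {p : Op} {a : ℕ} (h : a % 2 = p.parity) : (a + 1) % 2 = p.dual.parity := by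
  cases p <;> simp only [Op.parity, Op.dual] at * <;> omega

theorem mem_allInputs {n m i : ℕ} :
    i ∈ allInputs n m ↔ (i < 2 * n ∧ i % 2 = 0) ∨ (2 * n ≤ i ∧ i < 2 * n + m) := by
  simp only [allInputs, symInputs, altInputs, List.mem_append, List.mem_map, List.mem_range]
  constructor
  · rintro (⟨j, hj, rfl⟩ | ⟨j, hj, rfl⟩) <;> omega
  · rintro (⟨h1, h2⟩ | ⟨h1, h2⟩)
    · exact Or.inl ⟨i / 2, by omega, by omega⟩
    · exact Or.inr ⟨i - 2 * n, by omega, by omega⟩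

theorem altInputs_eq_range' (n m : ℕ) : altInputs n m = List.range' (2 * n) m :=
  (List.range'_eq_map_range ..).symm

theorem allInputs_succ (n m : ℕ) : allInputs n (m + 1) = allInputs n m ++ [2 * n + m] := by
  simp [allInputs, altInputs, List.range_succ]

theorem nodup_symInputs (n : ℕ) : (symInputs n).Nodup :=
  List.nodup_range.map fun a b h => by simpa using h

theorem nodup_allInputs (n m : ℕ) : (allInputs n m).Nodup := by
  rw [allInputs, List.nodup_append']
  refine ⟨nodup_symInputs n, altInputs_eq_range' n m ▸ List.nodup_range', fun i h1 h2 => ?_⟩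
  simp only [symInputs, altInputs, List.mem_map, List.mem_range] at h1 h2
  omega

theorem filter_even_allInputs (n m : ℕ) :
    (allInputs n m).filter (fun i => i % 2 = 0) =
      (List.range ((2 * n + m + 1) / 2)).map (fun i => 2 * i) := by
  induction m with
  | zero =>
    rw [show (2 * n + 0 + 1) / 2 = n by omega]
    simp [allInputs, symInputs, altInputs]
  | succ m ih =>
    rw [allInputs_succ, List.filter_append, ih]
    rcases Nat.mod_two_eq_zero_or_one m with h | h
    · rw [show (2 * n + (m + 1) + 1) / 2 = (2 * n + m + 1) / 2 + 1 by omega, List.range_succ,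
        List.map_append, List.filter_cons_of_pos (by simp; omega)]
      simp only [List.filter_nil, List.map_cons, List.map_nil]
      congr 2
      omega
    · rw [show (2 * n + (m + 1) + 1) / 2 = (2 * n + m + 1) / 2 by omega,
        List.filter_cons_of_neg (by simp; omega), List.filter_nil, List.append_nil]

theorem filter_odd_allInputs (n m : ℕ) :
    (allInputs n m).filter (fun i => i % 2 = 1) =
      (List.range (m / 2)).map (fun i => 2 * n + 1 + 2 * i) := by
  induction m with
  | zero => simp [allInputs, symInputs, altInputs]
  | succ m ih =>
    rw [allInputs_succ, List.filter_append, ih]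
    rcases Nat.mod_two_eq_zero_or_one m with h | h
    · rw [show (m + 1) / 2 = m / 2 by omega,
        List.filter_cons_of_neg (by simp; omega), List.filter_nil, List.append_nil]
    · rw [show (m + 1) / 2 = m / 2 + 1 by omega, List.range_succ,
        List.map_append, List.filter_cons_of_pos (by simp; omega)]
      simp only [List.filter_nil, List.map_cons, List.map_nil]
      congr 2
      omega

theorem everySecond_range' (a k : ℕ) :
    everySecond (List.range' a k) = List.range' (a + 1) (k / 2) 2 := by
  induction k using Nat.twoStepInduction generalizing a with
  | zero => rfl
  | one => rfl
  | more k ih _ =>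
    rw [show (k + 2) / 2 = k / 2 + 1 by omega, List.range'_succ, List.range'_succ, everySecond, ih,
      List.range'_succ]

/-- The properties of the two leftist circuits, with gates `G`, on which the recursive
construction relies. -/
structure ForestSpec (n m : ℕ) (G : List Gate) (F : Op → List LTree) : Prop where
  realizes : ∀ p, ∀ T ∈ F p, T.Forall (Realizes p (allInputs n m) G)
  nodup : ∀ p, ((F p).flatMap LTree.leaves).Nodup
  mem : ∀ p i, i ∈ (F p).flatMap LTree.leaves ↔ i ∈ allInputs n m ∧ i % 2 = p.parity
  length_boundarySeq : ∀ (p : Op) (a k : ℕ), 2 * n ≤ a → a % 2 = p.parity → Odd k →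
    a + k ≤ 2 * n + m →
    2 ^ ((boundarySeq (F p.dual) (everySecond (List.range' a k))).length + 4) ≤ (k + 3) ^ 2

theorem isInterval_range' {l : List ℕ} {a b k : ℕ} (hl : ∀ (i : ℕ) (h : i < l.length),
    l[i] = b + 2 * i) (hab : b ≤ a) (hpar : a % 2 = b % 2) :
    IsInterval l (List.range' a k 2) ((a - b) / 2) ((a - b) / 2 + k) := by
  intro i hi
  rw [hl i hi, List.mem_range']
  constructor
  · rintro ⟨j, hj, h⟩; omega
  · rintro ⟨h1, h2⟩; exact ⟨i - (a - b) / 2, by omega, by omega⟩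

/-- Every second input of a contiguous block is an interval, of length `(k - 1) / 2` as `k` is odd,
in the leftist circuit of the other parity. -/
theorem pow_length_boundarySeq_everySecond_le {p : Op} {l : List ℕ} {g a b k : ℕ}
    (hl : ∀ (i : ℕ) (h : i < l.length), l[i] = b + 2 * i) (hab : b ≤ a + 1)
    (hpar : (a + 1) % 2 = b % 2) (hk : Odd k) (hlen : a + k ≤ b + 2 * l.length) :
    2 ^ ((boundarySeq (leftist p l g).1 (everySecond (List.range' a k))).length + 4) ≤
      (k + 3) ^ 2 := by
  rw [everySecond_range']
  have hk' := Nat.odd_iff.1 hk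
  have h := pow_length_boundarySeq_leftist_le (p := p) (g := g)
    (isInterval_range' (k := k / 2) hl hab hpar) (by omega) (by omega)
  rw [Nat.add_sub_cancel_left] at h
  calc _ = 4 * 2 ^ ((boundarySeq (leftist p l g).1 (List.range' (a + 1) (k / 2) 2)).length + 2) := by
        ring
    _ ≤ 4 * (k / 2 + 2) ^ 2 := by omega
    _ = (2 * (k / 2) + 4) ^ 2 := by ring
    _ = (k + 3) ^ 2 := by congr 1; omega

/-! ### Symmetric trees -/

theorem boundarySeq_nil (F : List LTree) : boundarySeq F [] = [] := by
  rw [boundarySeq, List.flatMap_eq_nil_iff]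
  exact fun T _ => LTree.boundary_eq_nil (by simp)

section Build

variable {n m : ℕ} {G : List Gate} {F : Op → List LTree}

theorem ForestSpec.realizes_boundarySeq (hF : ForestSpec n m G F) (p : Op) (K : List ℕ) {T : LTree}
    (hT : T ∈ boundarySeq (F p) K) : Realizes p (allInputs n m) G T := by
  obtain ⟨S, hS, hT⟩ := List.mem_flatMap.1 hT
  exact LTree.forall_of_mem_boundary (hF.realizes p S hS) hT

/-- The boundary roots already compute the operation on their leaves, and these leaves make up `K`;
Huffman coding does the rest. -/
theorem ForestSpec.exists_symTree (hF : ForestSpec n m G F) (p : Op) {K : List ℕ}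
    (hK : ∀ i ∈ K, i ∈ allInputs n m ∧ i % 2 = p.parity) (hne : K ≠ []) (L : List (ℕ × Term))
    (hL : ∀ a ∈ L, a.2.Valid (allInputs n m) G.length) :
    ∃ e, symTree p (F p) K L = some e ∧
      e.size + 1 = (boundarySeq (F p) K).length + (L.map fun a => a.2.size + 1).sum ∧
      e.Valid (allInputs n m) G.length ∧
      ∀ x, e.eval x (gateValues x G) = p.apply (bigOp p (K.map x))
        (bigOp p (L.map fun a => a.2.eval x (gateValues x G))) := by
  set B := boundarySeq (F p) K with hB
  set l := B.map (fun T => (T.depth, Term.vertex T.root)) ++ L with hl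
  have hperm := foldr_insertByTime_perm l
  have hmem : ∀ i, i ∈ B.flatMap LTree.leaves ↔ i ∈ K := by
    intro i
    rw [hB, flatMap_leaves_boundarySeq, List.mem_filter, hF.mem]
    simpa using hK i
  have hBne : B ≠ [] := by
    intro h
    obtain ⟨i, hi⟩ := List.exists_mem_of_ne_nil _ hne
    rw [← hmem, h] at hi
    simp at hi
  obtain ⟨e, h1, h2, h3, h4⟩ := exists_huffman p (l.foldr insertByTime []) (by
    intro h
    rw [h] at hperm
    exact hBne (by simpa using (List.append_eq_nil_iff.1 (hperm.nil_eq).symm).1))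
  refine ⟨e, h1, ?_, h4 _ _ fun a ha => ?_, fun x => ?_⟩
  · rw [h2, (hperm.map _).sum_eq, hl, List.map_append, List.sum_append, List.map_map]
    congr 1
    simp [Function.comp_def, Term.size]
  · rcases List.mem_append.1 (hperm.mem_iff.1 ha) with h | h
    · obtain ⟨T, hT, rfl⟩ := List.mem_map.1 h
      exact (hF.realizes_boundarySeq p K hT).valid
    · exact hL a h
  · rw [h3, bigOp_perm p (hperm.map _), hl, List.map_append, bigOp_append, List.map_map,
      ← bigOp_map_congr p x hmem, bigOp_flatMap]
    congr 2
    exact List.map_congr_left fun T hT => (hF.realizes_boundarySeq p K hT).value x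

/-! ### The recursive construction -/

theorem ForestSpec.exists_baseCase (hF : ForestSpec n m G F) (p : Op) {s : List ℕ} {a k : ℕ}
    (hs : ∀ i ∈ s, i ∈ allInputs n m ∧ i % 2 = p.parity) (ha : 2 * n ≤ a)
    (hap : a % 2 = p.parity) (hk : 1 ≤ k) (hk5 : k ≤ 5) (hak : a + k ≤ 2 * n + m) :
    ∃ e, baseCase F p s (List.range' a k) = some e ∧
      e.Valid (allInputs n m) G.length ∧
      (∀ x, e.eval x (gateValues x G) =
        p.apply (bigOp p (s.map x)) (altPath p ((List.range' a k).map x))) ∧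
      e.size ≤ (boundarySeq (F p) s).length + smallBound k := by
  have hinp : ∀ i < k, a + i ∈ allInputs n m := fun i hi => mem_allInputs.2 (by omega)
  have hK : ∀ i ∈ s ++ [a], i ∈ allInputs n m ∧ i % 2 = p.parity := by
    intro i hi
    rcases List.mem_append.1 hi with h | h
    · exact hs i h
    · rw [List.mem_singleton.1 h]
      exact ⟨hinp 0 hk, hap⟩
  have hB := length_boundarySeq_append_le (F p) s a (hF.nodup p)
  have hsym := hF.exists_symTree p hK (by simp)
  interval_cases k
  · obtain ⟨e, h1, h2, h3, h4⟩ := hsym [] (by simp)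
    refine ⟨e, h1, h3, fun x => ?_, ?_⟩
    · rw [h4, List.map_nil, apply_bigOp_nil_right, List.map_append, bigOp_append]
      simp [bigOp_singleton, altPath_singleton]
    · simp [smallBound] at h2 ⊢; omega
  · obtain ⟨e, h1, h2, h3, h4⟩ := hsym [(0, inp (a + 1))] (by
      simp only [List.mem_singleton, forall_eq]
      exact hinp 1 (by omega))
    refine ⟨e, h1, h3, fun x => ?_, ?_⟩
    · rw [h4, List.map_append, bigOp_append]
      simp only [List.range', List.map_cons, List.map_nil, Term.eval, inp, Vertex.value]
      generalize bigOp p (s.map x) = S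
      generalize x a = y₀
      generalize x (a + 1) = y₁
      revert S y₀ y₁
      cases p <;> decide
    · simp [smallBound, Term.size, inp] at h2 ⊢; omega
  · obtain ⟨e, h1, h2, h3, h4⟩ := hsym [(1, .gate p.dual (inp (a + 1)) (inp (a + 1 + 1)))]
      (by simpa using ⟨hinp 1 (by omega), hinp 2 (by omega)⟩)
    refine ⟨e, h1, h3, fun x => ?_, ?_⟩
    · rw [h4, List.map_append, bigOp_append]
      simp only [List.range', List.map_cons, List.map_nil, Term.eval, inp, Vertex.value]
      generalize bigOp p (s.map x) = S
      generalize x a = y₀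
      generalize x (a + 1) = y₁
      generalize x (a + 1 + 1) = y₂
      revert S y₀ y₁ y₂
      cases p <;> decide
    · simp [smallBound, Term.size, inp] at h2 ⊢; omega
  · obtain ⟨e, h1, h2, h3, h4⟩ := hsym [(2, .gate p.dual (inp (a + 1))
        (.gate p (inp (a + 1 + 1)) (inp (a + 1 + 1 + 1))))]
      (by simpa using ⟨hinp 1 (by omega), hinp 2 (by omega), hinp 3 (by omega)⟩)
    refine ⟨e, h1, h3, fun x => ?_, ?_⟩
    · rw [h4, List.map_append, bigOp_append]
      simp only [List.range', List.map_cons, List.map_nil, Term.eval, inp, Vertex.value]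
      generalize bigOp p (s.map x) = S
      generalize x a = y₀
      generalize x (a + 1) = y₁
      generalize x (a + 1 + 1) = y₂
      generalize x (a + 1 + 1 + 1) = y₃
      revert S y₀ y₁ y₂ y₃
      cases p <;> decide
    · simp [smallBound, Term.size, inp] at h2 ⊢; omega
  · obtain ⟨e, h1, h2, h3, h4⟩ := hsym [(1, .gate p.dual (inp (a + 1)) (inp (a + 1 + 1)))]
      (by simpa using ⟨hinp 1 (by omega), hinp 2 (by omega)⟩)
    have hp1 := Op.parity_dual hap
    obtain ⟨e', h1', h2', h3', h4'⟩ := hF.exists_symTree p.dual (K := [a + 1, a + 1 + 1 + 1])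
      (by
        simp only [List.mem_cons, List.not_mem_nil, or_false, forall_eq_or_imp, forall_eq]
        exact ⟨⟨hinp 1 (by omega), hp1⟩, hinp 3 (by omega), by omega⟩)
      (by simp) [(0, inp (a + 1 + 1 + 1 + 1))] (by
        simp only [List.mem_singleton, forall_eq]
        exact hinp 4 (by omega))
    -- Two inputs have at most two boundary vertices, so the Or-tree (for `p = .and`) takes at most
    -- two gates.
    have hB1 := length_boundarySeq_append_le (F p.dual) [] (a + 1) (hF.nodup _)
    have hB2 := length_boundarySeq_append_le (F p.dual) [a + 1] (a + 1 + 1 + 1) (hF.nodup _)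
    simp only [boundarySeq_nil, List.nil_append, List.length_nil, List.singleton_append] at hB1 hB2
    refine ⟨.gate p e e', ?_, ⟨h3, h3'⟩, fun x => ?_, ?_⟩
    · simp only [List.range', baseCase, h1, h1']
      rfl
    · rw [Term.eval, h4, h4', List.map_append, bigOp_append]
      simp only [List.range', List.map_cons, List.map_nil, Term.eval, inp, Vertex.value]
      generalize bigOp p (s.map x) = S
      generalize x a = y₀
      generalize x (a + 1) = y₁
      generalize x (a + 1 + 1) = y₂
      generalize x (a + 1 + 1 + 1) = y₃
      generalize x (a + 1 + 1 + 1 + 1) = y₄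
      revert S y₀ y₁ y₂ y₃ y₄
      cases p <;> decide
    · simp [smallBound, Term.size, inp] at h2 h2' ⊢; omega

theorem le_five_of_dMin_le_three {ξ : ℝ} (hξ : 1 ≤ ξ) (hξ' : ξ < 2) {n m : ℕ}
    (h : dMin ξ n m ≤ 3) : m ≤ 5 := by
  obtain ⟨h1, h2⟩ := dMin_spec hξ n m
  have h3 := (mu_antitone (by linarith) (dMin ξ n m) (Nat.zero_le n)).trans
    (mu_zero_mono (ξ := ξ) (by linarith) h1 h)
  have h4 : mu ξ 3 0 < 6 := by norm_num [mu]; linarith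
  have : (m : ℝ) < 6 := by linarith
  have : m < 6 := by exact_mod_cast this
  omega

/-- The level `j` is independent of `d_min`: many symmetric inputs can make `d_min` exceed `j`, but
splitting them off costs nothing beyond `|B(s)|`. Every recursive call decreases `s.length + k`, so
the fuel suffices. -/
theorem ForestSpec.exists_build (hF : ForestSpec n m G F) {ξ : ℝ} (hξ : 1.9961 ≤ ξ) (hξ' : ξ < 2)
    (fuel : ℕ) (p : Op) (s : List ℕ) (a k j : ℕ) (hsn : s.Nodup)
    (hs : ∀ i ∈ s, i ∈ allInputs n m ∧ i % 2 = p.parity) (ha : 2 * n ≤ a)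
    (hap : a % 2 = p.parity) (hk : 1 ≤ k) (hak : a + k ≤ 2 * n + m) (hfuel : s.length + k ≤ fuel)
    (hj : 3 ≤ j) (hkj : (k : ℝ) ≤ mu ξ j 0) :
    ∃ e, build ξ F fuel p s (List.range' a k) = some e ∧
      e.Valid (allInputs n m) G.length ∧
      (∀ x, e.eval x (gateValues x G) =
        p.apply (bigOp p (s.map x)) (altPath p ((List.range' a k).map x))) ∧
      (e.size : ℝ) ≤ (boundarySeq (F p) s).length + bound j k := by
  have hξ1 : 1 ≤ ξ := by linarith
  have hξ0 : 0 ≤ ξ := by linarith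
  induction fuel generalizing p s a k j with
  | zero => omega
  | succ fuel ih =>
    obtain ⟨hd1, hd2⟩ := dMin_spec hξ1 s.length k
    simp only [build, List.length_range']
    split_ifs with hbase hsymm hsimple
    · have hk5 : k ≤ 5 := hbase.elim (by omega) (le_five_of_dMin_le_three hξ1 hξ')
      obtain ⟨e, h1, h2, h3, h4⟩ := hF.exists_baseCase p hs ha hap hk hk5 hak
      refine ⟨e, h1, h2, h3, ?_⟩
      have h5 := bound_mono hj k
      rw [bound, if_pos (by norm_num)] at h5
      have h6 : (e.size : ℝ) ≤ (boundarySeq (F p) s).length + smallBound k := by exact_mod_cast h4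
      linarith
    · have hne : s ≠ [] := by
        rintro rfl
        simp at hsymm
      obtain ⟨s', h1, h2, h3, h4⟩ := exists_triangularSubset (hF.nodup p) hsn
        (fun i hi => (hF.mem p i).2 (hs i hi))
        (fun T hT => (hF.realizes_boundarySeq p s hT).full) hne
      obtain ⟨e₁, f1, f2, f3, f4⟩ := hF.exists_symTree p (fun i hi => hs i (h3 i hi)) h2 []
        (by simp)
      have hlt : (s.filter fun i => i ∉ s').length < s.length := by
        obtain ⟨i, hi⟩ := List.exists_mem_of_ne_nil _ h2
        exact List.length_filter_lt_length_iff_exists.2 ⟨i, h3 i hi, by simpa using hi⟩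
      obtain ⟨e₂, g1, g2, g3, g4⟩ := ih p (s.filter fun i => i ∉ s') a k j (hsn.filter _)
        (fun i hi => hs i (List.mem_filter.1 hi).1) ha hap hk hak (by omega) hj hkj
      refine ⟨.gate p e₁ e₂, ?_, ⟨f3, g2⟩, fun x => ?_, ?_⟩
      · simp only [h1, f1, g1, Option.bind_eq_bind, Option.bind_some]
      · rw [Term.eval, f4, g3, List.map_nil, apply_bigOp_nil_right, ← apply_assoc, ← bigOp_append,
          ← List.map_append]
        congr 1
        refine bigOp_map_congr p x fun i => ?_
        simp only [List.mem_append, List.mem_filter, decide_eq_true_eq]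
        by_cases hi : i ∈ s'
        · simp [hi, h3 i hi]
        · simp [hi]
      · simp only [List.map_nil, List.sum_nil, add_zero] at f2
        have h5 : (e₁.size : ℝ) + 1 + (boundarySeq (F p) (s.filter fun i => i ∉ s')).length =
            (boundarySeq (F p) s).length := by
          rw [← h4, ← f2]; push_cast; ring
        rw [Term.size]
        push_cast
        linarith
    · have hd4 : 3 < dMin ξ s.length k := by omega
      -- For empty `s`, minimality of `d_min` contradicts `m ≤ μ(d - 1, 0)`; so a simple split makes
      -- progress.
      have hne : s ≠ [] := by
        rintro rfl
        have := mu_lt_of_lt_dMin (ξ := ξ) (n := 0) (m := k) (d := dMin ξ 0 k - 1)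
          (by simp at hd4; omega) (by simp at hd4; omega)
        simp only [List.length_nil] at hsimple
        linarith
      obtain ⟨e₁, f1, f2, f3, f4⟩ := hF.exists_symTree p hs hne [] (by simp)
      have hpos := List.length_pos_of_ne_nil hne
      obtain ⟨e₂, g1, g2, g3, g4⟩ := ih p [] a k j List.nodup_nil (by simp) ha hap hk hak
        (by simp; omega) hj hkj
      refine ⟨.gate p e₁ e₂, ?_, ⟨f3, g2⟩, fun x => ?_, ?_⟩
      · simp only [f1, g1, Option.bind_eq_bind, Option.bind_some]
      · rw [Term.eval, f4, g3, List.map_nil, apply_bigOp_nil_right, List.map_nil, apply_bigOp_nil]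
      · simp only [List.map_nil, List.sum_nil, add_zero] at f2
        rw [boundarySeq_nil, List.length_nil, Nat.cast_zero, zero_add] at g4
        rw [Term.size, ← f2]
        push_cast
        linarith
    · obtain ⟨d, hd⟩ : ∃ d, dMin ξ s.length k = d + 1 := ⟨_, (Nat.sub_add_cancel hd1).symm⟩
      rw [hd] at hd2 hbase hsymm hsimple
      simp only [hd, Nat.add_sub_cancel] at hsymm hsimple ⊢
      have hd3 : 3 ≤ d := by omega
      rw [not_le] at hsymm hsimple
      have hmu1 := one_le_mu hξ0 hξ' hd3 hsymm
      have hmuk : mu ξ d s.length < k := mu_lt_of_lt_dMin (by omega) (by omega)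
      obtain ⟨ho, hl, hu⟩ := oddFloor_spec hmu1
      set l := oddFloor (mu ξ d s.length)
      have hlk : l < k := by exact_mod_cast hl.trans_lt hmuk
      have hl2 := Nat.odd_iff.1 ho
      -- No simple split was possible, so `μ(d, 0) < k ≤ μ(j, 0)`.
      have hdj : d + 1 ≤ j := by
        by_contra hc
        have := mu_zero_mono (ξ := ξ) hξ0 (by omega : 1 ≤ j) (by omega : j ≤ d)
        linarith
      have hl0 : (l : ℝ) ≤ mu ξ d 0 := hl.trans (mu_antitone hξ0 d (Nat.zero_le _))
      -- Rounding down to an odd number loses less than 2, the slack provided by `mu_succ_sub_le`.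
      have hr0 : ((k - l : ℕ) : ℝ) ≤ mu ξ d 0 := by
        have := mu_succ_sub_le hξ1 hξ' hd3 hsymm hsimple hd2
        rw [Nat.cast_sub hlk.le]
        linarith
      have htake : (List.range' a k).take l = List.range' a l := by
        exact List.take_range'_of_length_ge hlk.le
      have hdrop : (List.range' a k).drop l = List.range' (a + l) (k - l) := by
        rw [List.drop_range', mul_one]
      rw [htake, hdrop]
      obtain ⟨e₁, f1, f2, f3, f4⟩ := ih p s a l d hsn hs ha hap (by omega) (by omega) (by omega)
        hd3 hl0
      have hp1 := Op.parity_dual hap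
      obtain ⟨e₂, g1, g2, g3, g4⟩ := ih p.dual (everySecond (List.range' a l)) (a + l) (k - l) d
        (by rw [everySecond_range']; exact List.nodup_range' 2)
        (by
          intro i hi
          rw [everySecond_range', List.mem_range'] at hi
          obtain ⟨i', hi', rfl⟩ := hi
          exact ⟨mem_allInputs.2 (by omega), by omega⟩)
        (by omega) (by omega) (by omega) (by omega)
        (by rw [everySecond_range', List.length_range']; omega) hd3 hr0
      refine ⟨.gate p e₁ e₂, ?_, ⟨f2, g2⟩, fun x => ?_, ?_⟩
      · simp only [f1, g1, Option.bind_eq_bind, Option.bind_some]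
      · have hsplit : List.range' a k = List.range' a l ++ List.range' (a + l) (k - l) := by
          rw [← htake, ← hdrop, List.take_append_drop]
        rw [Term.eval, f3, g3, hsplit, altPath_append x p _ _ (by simpa using ho)
          (by simp; omega), apply_assoc]
      · have hc := hF.length_boundarySeq p a l ha hap ho (by omega)
        have hb := bound_add_add_le hξ hξ' hd3 ho (by omega : 1 ≤ k - l) hl0 hr0
          (by rwa [Nat.add_sub_cancel' hlk.le])
          (by
            rw [Nat.add_sub_cancel' hlk.le]
            exact hd2.trans (mu_antitone hξ0 _ (Nat.zero_le _))) hc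
        rw [Nat.add_sub_cancel' hlk.le] at hb
        have hb' := bound_mono hdj k
        rw [Term.size]
        push_cast
        linarith

end Build

/-! ### The circuit -/

/-- For `n ≥ 4`, `(n + 2) / 2 ≤ n - 1`, hence `2^b ≤ (n - 1)²`. For `n = 3`, integrality of `b`
gives `b ≤ 2`. -/
theorem le_rho {b n : ℕ} (h : 2 ^ (b + 2) ≤ (n + 2) ^ 2) : b ≤ rho n := by
  unfold rho
  split
  · next hn =>
    by_contra hc
    have h1 := (Nat.pow_le_pow_right (by norm_num : 0 < 2) (by omega : n + 3 ≤ b + 2)).trans h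
    interval_cases n <;> norm_num at h1
  · next hn =>
    have hn4 : b + 2 ≤ 4 ∨ 4 ≤ n := by
      by_contra hc
      rw [not_or] at hc
      have h1 := (Nat.pow_le_pow_right (by norm_num : 0 < 2) (by omega : 5 ≤ b + 2)).trans h
      have : n = 3 := by omega
      subst this
      norm_num at h1
    have h2 : (2 : ℝ) ^ b ≤ ((n : ℝ) - 1) ^ 2 := by
      have hn3 : (3 : ℝ) ≤ n := by exact_mod_cast (by omega : 3 ≤ n)
      rcases hn4 with hb | hn4
      · calc (2 : ℝ) ^ b ≤ 2 ^ 2 := pow_le_pow_right₀ (by norm_num) (by omega)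
          _ ≤ ((n : ℝ) - 1) ^ 2 := by nlinarith
      · have h' : (2 : ℝ) ^ (b + 2) ≤ ((n : ℝ) + 2) ^ 2 := by exact_mod_cast h
        have hn4' : (4 : ℝ) ≤ n := by exact_mod_cast hn4
        rw [pow_add] at h'
        nlinarith
    have hpos : (0 : ℝ) < (n : ℝ) - 1 := by
      have : (3 : ℝ) ≤ n := by exact_mod_cast (by omega : 3 ≤ n)
      linarith
    refine Nat.le_floor ?_
    have := Real.logb_le_logb_of_le (b := 2) (by norm_num) (by positivity) h2
    rw [Real.logb_pow, Real.logb_pow, Real.logb_self_eq_one (by norm_num)] at this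
    push_cast at this
    linarith

theorem map_globalInput_symInputs {n m : ℕ} (s : Fin n → Bool) (t : Fin m → Bool) :
    (symInputs n).map (globalInput s t) = List.ofFn s := by
  refine List.ext_getElem (by simp [symInputs]) fun i h1 h2 => ?_
  have hi : i < n := by simpa using h2
  simp [symInputs, globalInput, hi]

theorem map_globalInput_altInputs {n m : ℕ} (s : Fin n → Bool) (t : Fin m → Bool) :
    (altInputs n m).map (globalInput s t) = List.ofFn t := by
  refine List.ext_getElem (by simp [altInputs]) fun i h1 h2 => ?_
  have hi : i < m := by simpa using h2
  simp [altInputs, globalInput, hi]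

/-- The leftist circuits on the even and on the odd global inputs. -/
theorem forestSpec_leftist (n m : ℕ) (S₀ S₁ : List LTree × List Gate)
    (h₀ : S₀ = leftist .and ((allInputs n m).filter (fun i => i % 2 = 0)) 0)
    (h₁ : S₁ = leftist .or ((allInputs n m).filter (fun i => i % 2 = 1)) S₀.2.length) :
    GatesFrom (allInputs n m) 0 (S₀.2 ++ S₁.2) ∧
      S₀.2.length ≤ (2 * n + m + 1) / 2 - 1 ∧ S₁.2.length ≤ m / 2 - 1 ∧
      ForestSpec n m (S₀.2 ++ S₁.2) (fun p => match p with
        | .and => S₀.1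
        | .or => S₁.1) := by
  have s₀ := leftist_spec .and (I := allInputs n m)
    ((allInputs n m).filter (fun i => i % 2 = 0)) [] fun i hi => (List.mem_filter.1 hi).1
  have s₁ := leftist_spec .or (I := allInputs n m)
    ((allInputs n m).filter (fun i => i % 2 = 1)) S₀.2 fun i hi => (List.mem_filter.1 hi).1
  rw [List.length_nil, ← h₀] at s₀
  rw [← h₁] at s₁
  obtain ⟨a1, a2, a3, a4⟩ := s₀
  obtain ⟨b1, b2, b3, b4⟩ := s₁
  refine ⟨a3.append (by rwa [zero_add]), ?_, ?_, ?_, ?_, ?_, ?_⟩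
  · simpa [filter_even_allInputs] using a2
  · simpa [filter_odd_allInputs] using b2
  · rintro (_ | _) T hT
    · exact (a4 T hT).mono fun T h => h.append _
    · exact b4 T hT
  · rintro (_ | _)
    · simpa only [a1] using (nodup_allInputs n m).filter _
    · simpa only [b1] using (nodup_allInputs n m).filter _
  · rintro (_ | _) i
    · simp only [a1, List.mem_filter, decide_eq_true_eq, Op.parity]
    · simp only [b1, List.mem_filter, decide_eq_true_eq, Op.parity]
  -- The leftist Or-circuit lists the odd inputs from `2 n + 1` on, the And-circuit all even inputs
  -- from 0 on; both lists have step 2.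
  · rintro (_ | _) a k ha hap hk hak <;> simp only [Op.parity] at hap <;>
      have hk' := Nat.odd_iff.1 hk
    · simp only [Op.dual, h₁, filter_odd_allInputs]
      exact pow_length_boundarySeq_everySecond_le (b := 2 * n + 1) (by simp) (by omega) (by omega)
        hk (by simp; omega)
    · simp only [Op.dual, h₀, filter_even_allInputs]
      exact pow_length_boundarySeq_everySecond_le (b := 0) (by simp) (by omega) (by omega)
        hk (by simp; omega)

theorem length_boundarySeq_symInputs_le (n m g : ℕ) :
    (boundarySeq (leftist .and ((allInputs n m).filter (fun i => i % 2 = 0)) g).1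
      (symInputs n)).length ≤ rho n := by
  have h : IsInterval ((allInputs n m).filter (fun i => i % 2 = 0)) (symInputs n) 0 n := by
    rw [filter_even_allInputs]
    intro i hi
    simp [symInputs]
  exact le_rho (pow_length_boundarySeq_leftist_le (p := .and) (g := g) h (Nat.zero_le n)
    (by simp [filter_even_allInputs]; omega))

end AndOrPath

end

/-! ### The size bound -/

open AndOrPath in
theorem mainTheorem2 (ξ : ℝ) (hξ : 1.9961 ≤ ξ) (hξ' : ξ < 2) (n m : ℕ) (hm : 1 ≤ m) :
    ∃ C : Circuit, andOrPathCircuit ξ n m = some C ∧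
      C.WellFormed (allInputs n m) ∧
      (∀ (s : Fin n → Bool) (t : Fin m → Bool),
        C.eval (globalInput s t) = extAndOrPath s t) ∧
      (C.size : ℝ) ≤ 3.67 * m + n + rho n - 2 := by
  obtain ⟨S₀, h₀⟩ : ∃ S, S = leftist .and ((allInputs n m).filter (fun i => i % 2 = 0)) 0 :=
    ⟨_, rfl⟩
  obtain ⟨S₁, h₁⟩ : ∃ S,
      S = leftist .or ((allInputs n m).filter (fun i => i % 2 = 1)) S₀.2.length := ⟨_, rfl⟩
  obtain ⟨hgates, hlen₀, hlen₁, hF⟩ := forestSpec_leftist n m S₀ S₁ h₀ h₁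
  have hB := length_boundarySeq_symInputs_le n m 0
  rw [← h₀] at hB
  obtain ⟨j, hj, hmj, hbound⟩ : ∃ j, 3 ≤ j ∧ (m : ℝ) ≤ mu ξ j 0 ∧
      ((S₀.2.length + S₁.2.length : ℕ) : ℝ) + bound j m ≤ 3.67 * m + n - 2 := by
    -- For `m = 1` the Or-circuit is empty and saves no gate, so the leftist circuits may have `n`
    -- gates instead of `n + m - 2`; the recursion then needs no gates beyond `|B(s)|`.
    rcases hm.eq_or_lt with rfl | hm2
    · refine ⟨3, le_rfl, ?_, ?_⟩
      · norm_num [mu]; linarith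
      · have h : ((S₀.2.length + S₁.2.length : ℕ) : ℝ) ≤ n := by exact_mod_cast by omega
        norm_num [bound, smallBound] at h ⊢
        linarith
    · obtain ⟨d, hd, hmd⟩ := exists_le_mu (by linarith : 1 ≤ ξ) 0 m
      refine ⟨max d 3, le_max_right _ _,
        hmd.trans (mu_zero_mono (by linarith) hd (le_max_left _ _)), ?_⟩
      have h : S₀.2.length + S₁.2.length + 2 ≤ n + m := by omega
      have h' : ((S₀.2.length + S₁.2.length : ℕ) : ℝ) + 2 ≤ n + m := by exact_mod_cast h
      -- The factor 3.67 is 1 for the leftist circuits plus 2.67 for the additional gates.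
      have := bound_le (max d 3) m
      linarith
  have hsym : ∀ i ∈ symInputs n, i ∈ allInputs n m ∧ i % 2 = Op.parity .and := by
    intro i hi
    refine ⟨List.mem_append_left _ hi, ?_⟩
    obtain ⟨i', -, rfl⟩ := List.mem_map.1 hi
    simp [Op.parity]
  obtain ⟨e, h1, h2, h3, h4⟩ := hF.exists_build hξ hξ' (n + m) .and (symInputs n) (2 * n) m j
    (nodup_symInputs n) hsym le_rfl (by simp [Op.parity]) hm le_rfl (by simp [symInputs]) hj hmj
  rw [← altInputs_eq_range'] at h1 h3
  have hemit := Term.emit_valid h2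
  refine ⟨⟨S₀.2 ++ S₁.2 ++ (e.emit (S₀.2 ++ S₁.2).length).2,
    (e.emit (S₀.2 ++ S₁.2).length).1⟩, ?_, ⟨?_, ?_⟩, fun s t => ?_, ?_⟩
  · unfold andOrPathCircuit
    simp only [← h₀, ← h₁, Option.bind_eq_bind, List.length_append]
    exact congrArg (fun o : Option Term => o.bind fun e =>
      some (⟨S₀.2 ++ S₁.2 ++ (e.emit (S₀.2.length + S₁.2.length)).2,
        (e.emit (S₀.2.length + S₁.2.length)).1⟩ : Circuit)) h1
  · intro i hi
    simpa only [zero_add] using (hgates.append (by simpa only [zero_add] using hemit.1)) i hi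
  · simpa only [List.length_append, Term.length_emit] using hemit.2
  · rw [Circuit.eval, Term.emit_value h2, h3, map_globalInput_symInputs,
      map_globalInput_altInputs]
    rfl
  · have hB' : ((boundarySeq S₀.1 (symInputs n)).length : ℝ) ≤ rho n := by exact_mod_cast hB
    simp only [Circuit.size, List.length_append, Term.length_emit]
    push_cast at hbound h4 ⊢
    linarith
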